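/- Let $(\Omega,\mathcal F,(\mathcal F_t)_{t\ge 0},\mathbf P)$ be a filtered probability space satisfying the usual conditions, and let $Y=(Y_t)_{t\ge0}$ be a real Lévy process on it with $Y_0=0$: $Y$ is adapted, has a.s. càdlàg paths and stationary increments, and $Y_t-Y_s$ is independent of $\mathcal F_s$ for $s\le t$. For $x\in\mathbb R$ put $X_t=x+Y_t$ and write $\mathbf E_x$ for expectations of functionals of this process started at $x$. Let $r\ge0$, let $e(r)$ be an exponential time of parameter $r$, independent of $Y$, if $r>0$, and $e(0)=\infty$; put $$M=\sup\{X_t : 0\le t\le e(r)\},$$ and assume that $M$ is a.s. finite (a restriction only if $r=0$). Let $g:\mathbb R\to[0,\infty)$ be measurable with $\lim_{x\to-\infty}g(x)=0$. The payoff $e^{-r\tau}g(X_\tau)$ of a stopping time $\tau:\Omega\to[0,\infty]$ is, by convention, $\limsup_{t\to\infty}e^{-rt}g(X_t)$ on $\{\tau=\infty\}$. Assume that there are a point $x^*\in\mathbb R$ and a non-decreasing function $G^*:[x^*,\infty)\to\mathbb R$ with $G^*(x^*)\ge 0$ such that, for all $x\ge x^*$, $G^*(M)$ is integrable under $\mathbf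 P_x$ and $$\mathbf E_x\,G^*(M)=g(x).$$ Define $G(y)=G^*(y)$ for $y\ge x^*$ and $G(y)=0$ for $y<x^*$ (so that $G$ is non-negative and non-decreasing), and $V(x)=\mathbf E_x\,G(M)$ for $x\in\mathbb R$. If $V(x)\ge g(x)$ for all $x<x^*$, then for every $x\in\mathbb R$ the variable $G(M)$ is integrable under $\mathbf P_x$ (so that $V(x)$ is finite), the time $\tau^*=\inf\{t\ge0 : X_t\ge x^*\}$ (with $\inf\emptyset=\infty$) is a stopping time, and $$V(x)=\sup_{\tau}\mathbf E_x\,e^{-r\tau}g(X_\tau)=\mathbf E_x\,e^{-r\tau^*}g(X_{\tau^*}),$$ the supremum being over all stopping times $\tau$ of $(\mathcal F_t)$ with values in $[0,\infty]$. That is, $V$ is the value function of the optimal stopping problem and $\tau^*$ is optimal. -/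

import Mathlib

open MeasureTheory ProbabilityTheory Filter Topology Set
open scoped NNReal ENNReal

namespace LevyStopping

noncomputable section

/-- A path is càdlàg: right-continuous with (finite) left limits at every time. -/
def IsCadlagPath (f : ℝ≥0 → ℝ) : Prop :=
  ∀ t : ℝ≥0, ContinuousWithinAt f (Ici t) t ∧ ∃ l : ℝ, Tendsto f (𝓝[<] t) (𝓝 l)

/-- The usual conditions on a filtration: it is right-continuous, and every subset of a `P`-null
set already belongs to the initial σ-algebra (here `P s = 0` is a statement about the outer
measure, so `s` is not assumed measurable). -/
structure UsualConditions {Ω : Type*} {mΩ : MeasurableSpace Ω} (P : Measure Ω)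
    (𝓕 : Filtration ℝ≥0 mΩ) : Prop where
  rightContinuous : 𝓕.IsRightContinuous
  complete : ∀ s : Set Ω, P s = 0 → MeasurableSet[𝓕 0] s

/-- `Y` is a real Lévy process issued from `0` on the stochastic basis `(Ω, mΩ, 𝓕, P)`. -/
structure IsLevyProcess {Ω : Type*} {mΩ : MeasurableSpace Ω} (P : Measure Ω)
    (𝓕 : Filtration ℝ≥0 mΩ) (Y : ℝ≥0 → Ω → ℝ) : Prop where
  adapted : ∀ t, Measurable[𝓕 t] (Y t)
  start_zero : ∀ᵐ ω ∂P, Y 0 ω = 0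
  cadlag : ∀ᵐ ω ∂P, IsCadlagPath fun t => Y t ω
  indep_increments : ∀ s t : ℝ≥0, s ≤ t →
    Indep (MeasurableSpace.comap (fun ω => Y t ω - Y s ω) inferInstance) (𝓕 s) P
  stationary_increments : ∀ s t : ℝ≥0,
    IdentDistrib (fun ω => Y (s + t) ω - Y s ω) (fun ω => Y t ω - Y 0 ω) P P

/-- The process started at `x`: the Lévy process issued from `0`, translated by `x`. -/
def startedAt {Ω : Type*} (Y : ℝ≥0 → Ω → ℝ) (x : ℝ) : ℝ≥0 → Ω → ℝ :=
  fun t ω => x + Y t ω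

/-- The law on `[0, ∞]` of the time `e(r)`: exponential of parameter `r` if `r > 0`, and
`e(0) = ∞`. -/
def horizonLaw (r : ℝ) : Measure ℝ≥0∞ :=
  if r = 0 then Measure.dirac ⊤ else (expMeasure r).map ENNReal.ofReal

/-- The joint law of the sample point and of an independent time `e(r)`. -/
def extendedLaw {Ω : Type*} {mΩ : MeasurableSpace Ω} (P : Measure Ω) (r : ℝ) :
    Measure (Ω × ℝ≥0∞) :=
  P.prod (horizonLaw r)

/-- The values `X_t(ω)`, `0 ≤ t ≤ T`, at the point `p = (ω, T)` of the extended space. -/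
def valuesUpTo {Ω : Type*} (X : ℝ≥0 → Ω → ℝ) (p : Ω × ℝ≥0∞) : Set ℝ :=
  {y | ∃ t : ℝ≥0, (t : ℝ≥0∞) ≤ p.2 ∧ y = X t p.1}

/-- The random variable `M = sup {X_t : 0 ≤ t ≤ e(r)}` on the extended space. -/
def overallSup {Ω : Type*} (X : ℝ≥0 → Ω → ℝ) (p : Ω × ℝ≥0∞) : ℝ :=
  sSup (valuesUpTo X p)

/-- The extension by `0` to the left of the threshold `a` of a function given on `[a, ∞)`. -/
def extendByZero (a : ℝ) (Gs : ℝ → ℝ) (y : ℝ) : ℝ :=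
  if a ≤ y then Gs y else 0

/-- `E_x F(M)`. -/
def expectSup {Ω : Type*} {mΩ : MeasurableSpace Ω} (P : Measure Ω) (r : ℝ)
    (Y : ℝ≥0 → Ω → ℝ) (F : ℝ → ℝ) (x : ℝ) : ℝ :=
  ∫ p, F (overallSup (startedAt Y x) p) ∂(extendedLaw P r)

/-- `E_x |F(M)| < ∞`. -/
def IntegrableSup {Ω : Type*} {mΩ : MeasurableSpace Ω} (P : Measure Ω) (r : ℝ)
    (Y : ℝ≥0 → Ω → ℝ) (F : ℝ → ℝ) (x : ℝ) : Prop :=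
  Integrable (fun p => F (overallSup (startedAt Y x) p)) (extendedLaw P r)

/-- The discounted payoff of stopping the process `X` at time `t`. -/
def discounted {Ω : Type*} (r : ℝ) (g : ℝ → ℝ) (X : ℝ≥0 → Ω → ℝ) (t : ℝ≥0) (ω : Ω) : ℝ≥0∞ :=
  ENNReal.ofReal (Real.exp (-r * t) * g (X t ω))

/-- The payoff of the stopping rule `τ`: `e^{-rτ} g(X_τ)` where `τ < ∞`, and
`limsup_{t → ∞} e^{-rt} g(X_t)` where `τ = ∞`. -/
def payoff {Ω : Type*} (r : ℝ) (g : ℝ → ℝ) (X : ℝ≥0 → Ω → ℝ) (τ : Ω → WithTop ℝ≥0) (ω : Ω) :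
    ℝ≥0∞ :=
  match τ ω with
  | none => limsup (fun t : ℝ≥0 => discounted r g X t ω) atTop
  | some t => discounted r g X t ω

/-- The expected payoff of the stopping rule `τ`, an element of `[0, ∞]`. -/
def expectedPayoff {Ω : Type*} {mΩ : MeasurableSpace Ω} (P : Measure Ω) (r : ℝ) (g : ℝ → ℝ)
    (X : ℝ≥0 → Ω → ℝ) (τ : Ω → WithTop ℝ≥0) : ℝ≥0∞ :=
  ∫⁻ ω, payoff r g X τ ω ∂P

/-- The optimal value: the supremum of the expected payoffs over all stopping times, with the
value `∞` allowed. -/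
def optimalValue {Ω : Type*} {mΩ : MeasurableSpace Ω} (P : Measure Ω) (𝓕 : Filtration ℝ≥0 mΩ)
    (r : ℝ) (g : ℝ → ℝ) (X : ℝ≥0 → Ω → ℝ) : ℝ≥0∞ :=
  ⨆ (τ : Ω → WithTop ℝ≥0) (_ : IsStoppingTime 𝓕 τ), expectedPayoff P r g X τ

/-- The first entrance time `inf {t ≥ 0 : X_t ≥ a}`, equal to `∞` if there is no such `t`. -/
def entranceTime {Ω : Type*} (X : ℝ≥0 → Ω → ℝ) (a : ℝ) : Ω → WithTop ℝ≥0 :=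
  hittingAfter X (Ici a) 0

end

end LevyStopping

open LevyStopping

/-!
# Optimal stopping of a Lévy process through its overall supremum

Write `X = x + Y`, let `e(r)` be the independent horizon, `M` the supremum of `X` up to `e(r)`, and
`V(x) = E_x G(M)`. Everything rests on one identity, which combines the strong Markov property of
`Y` with the lack of memory of `e(r)`: for every stopping time `τ`,

  `E[e^{-rτ} V(X_τ); τ < ∞] = E[G(sup {X_t : τ ≤ t ≤ e(r)}); τ < ∞, τ ≤ e(r)]`

(`IsRegularLevyProcess.lintegral_exp_mul_valueAt`).

* *Upper bound.* As `G` is monotone, the right-hand side is at most `E G(M) = V(x)`. Since `g ≤ V`,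
  with equality to the right of `xs`, no stopping time beats `V` on `{τ < ∞}`. The payoff on
  `{τ = ∞}` vanishes: for `r > 0` the discounted value `e^{-rt} V(X_t)` tends to `0`, by a maximal
  inequality that follows from the same identity
  (`IsRegularLevyProcess.ae_tendsto_exp_mul_supMean`). For `r = 0` a Lévy process that is bounded
  above drifts to `-∞`, where `g` tends to `0`, unless it is identically `0`
  (`IsRegularLevyProcess.ae_tendsto_atBot_or_ae_eq_zero`); in the latter case all rules pay `g x`.
* *Attainment.* For the entrance time `τ*` of `[xs, ∞)`, the suprema over `[τ*, e(r)]` and over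
  `[0, e(r)]` coincide on `{τ* ≤ e(r)}`. Off this event `X` stays below `xs` up to `e(r)`, and
  `G(M) = 0` because almost surely `M ≠ xs`: the process does not approach `xs` without reaching
  it (`IsRegularLevyProcess.ae_pathSup_ne_of_lt`). The same fact, for an exponential horizon of
  rate `1`, shows that `τ*` is a.s. the limit of the first passage times above `xs - 1 / (n + 1)`,
  and hence a stopping time under the usual conditions.

The argument is carried out for processes all of whose paths are right-continuous and start from
`0`; a general Lévy process is first set to `0` on a null set (`regularize`). Suprema are taken in
`EReal` and expressed through the countably many values along a dense sequence of times, so that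
they are measurable functionals of the path.
-/

namespace LevyStopping

/-! ### Running suprema of right-continuous paths -/

/-- The supremum of a path over the times `t ≤ T`, with values in `[-∞, ∞]`. -/
noncomputable def pathSup (f : ℝ≥0 → ℝ) (T : ℝ≥0∞) : EReal :=
  ⨆ (t : ℝ≥0) (_ : (t : ℝ≥0∞) ≤ T), (f t : EReal)

/-- A fixed sequence of times that is dense in `[0, ∞)`. -/
noncomputable def denseTime : ℕ → ℝ≥0 := TopologicalSpace.denseSeq ℝ≥0

/-- A measurable functional of the values of a path along `denseTime`. It computes the running
supremum of right-continuous paths, see `supFunctional_comp_denseTime`. The slack `1 / (n + 1)`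
makes room for times of the dense sequence that approach `T` from the right. -/
noncomputable def supFunctional (y : ℕ → ℝ) (T : ℝ≥0∞) : EReal :=
  ⨅ n : ℕ, ⨆ i : ℕ, if (denseTime i : ℝ≥0∞) < T + ((n : ℝ≥0∞) + 1)⁻¹ then (y i : EReal) else ⊥

lemma measurable_supFunctional {E : Type*} {mE : MeasurableSpace E} {u : E → ℕ → ℝ}
    {v : E → ℝ≥0∞} (hu : Measurable u) (hv : Measurable v) :
    Measurable fun e => supFunctional (u e) (v e) := by
  refine Measurable.iInf fun n => Measurable.iSup fun i => Measurable.ite ?_ ?_ measurable_const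
  · exact measurableSet_lt measurable_const (hv.add measurable_const)
  · exact measurable_coe_real_ereal.comp ((measurable_pi_apply i).comp hu)

lemma le_pathSup {f : ℝ≥0 → ℝ} {T : ℝ≥0∞} {t : ℝ≥0} (h : (t : ℝ≥0∞) ≤ T) :
    (f t : EReal) ≤ pathSup f T :=
  le_iSup₂ (f := fun (t : ℝ≥0) (_ : (t : ℝ≥0∞) ≤ T) => (f t : EReal)) t h

lemma pathSup_le {f : ℝ≥0 → ℝ} {T : ℝ≥0∞} {c : EReal}
    (h : ∀ t : ℝ≥0, (t : ℝ≥0∞) ≤ T → (f t : EReal) ≤ c) : pathSup f T ≤ c :=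
  iSup₂_le h

lemma exists_denseTime_mem_Ioo {s t : ℝ≥0} (h : s < t) : ∃ i, denseTime i ∈ Ioo s t :=
  (TopologicalSpace.denseRange_denseSeq ℝ≥0).exists_mem_open isOpen_Ioo (nonempty_Ioo.2 h)

lemma supFunctional_comp_denseTime {f : ℝ≥0 → ℝ}
    (hf : ∀ t, ContinuousWithinAt f (Ici t) t) (T : ℝ≥0∞) :
    supFunctional (fun i => f (denseTime i)) T = pathSup f T := by
  apply le_antisymm
  · refine le_of_forall_gt fun c hc => ?_
    obtain ⟨c', hc', hc'c⟩ := exists_between hc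
    refine lt_of_le_of_lt ?_ hc'c
    induction T with
    | top =>
      refine (iInf_le _ 0).trans (iSup_le fun i => ?_)
      split_ifs
      · exact (le_pathSup le_top).trans hc'.le
      · exact bot_le
    | coe a =>
      have h1 : ∀ᶠ s in 𝓝[≥] a, (f s : EReal) < c' := by
        have : ContinuousWithinAt (fun s => (f s : EReal)) (Ici a) a :=
          continuous_coe_real_ereal.continuousAt.comp_continuousWithinAt (hf a)
        exact this.eventually (eventually_lt_nhds ((le_pathSup le_rfl).trans_lt hc'))
      obtain ⟨u, hu, hsub⟩ := (mem_nhdsGE_iff_exists_Ico_subset).1 h1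
      have hu' : (0 : ℝ≥0∞) < ((u - a : ℝ≥0) : ℝ≥0∞) := by
        simpa using hu
      obtain ⟨n, hn⟩ := ENNReal.exists_inv_nat_lt hu'.ne'
      refine (iInf_le _ n).trans (iSup_le fun i => ?_)
      split_ifs with hi
      · by_cases hia : denseTime i ≤ a
        · exact (le_pathSup (by exact_mod_cast hia)).trans hc'.le
        · refine le_of_lt (hsub ⟨(not_le.1 hia).le, ?_⟩)
          have h2 : (denseTime i : ℝ≥0∞) < a + ((u - a : ℝ≥0) : ℝ≥0∞) :=
            hi.trans_le (add_le_add_right ((ENNReal.inv_le_inv.2 le_self_add).trans hn.le) _)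
          rw [← ENNReal.coe_add, add_tsub_cancel_of_le (show a ≤ u from le_of_lt hu)] at h2
          exact_mod_cast h2
      · exact bot_le
  · refine le_iInf fun n => pathSup_le fun t ht => ?_
    refine le_of_forall_lt fun c hc => ?_
    have h1 : ∀ᶠ s in 𝓝[>] t, c < (f s : EReal) := by
      have : ContinuousWithinAt (fun s => (f s : EReal)) (Ici t) t :=
        continuous_coe_real_ereal.continuousAt.comp_continuousWithinAt (hf t)
      exact (this.mono Ioi_subset_Ici_self).eventually (eventually_gt_nhds hc)
    have h2 : ∀ᶠ s : ℝ≥0 in 𝓝[>] t, (s : ℝ≥0∞) < T + ((n : ℝ≥0∞) + 1)⁻¹ := by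
      have hlt : (t : ℝ≥0∞) < T + ((n : ℝ≥0∞) + 1)⁻¹ :=
        (ENNReal.lt_add_right ENNReal.coe_ne_top (by simp)).trans_le (add_le_add_left ht _)
      exact nhdsWithin_le_nhds
        ((ENNReal.continuous_coe.tendsto t).eventually (eventually_lt_nhds hlt))
    obtain ⟨u, hu, hsub⟩ := (mem_nhdsGT_iff_exists_Ioo_subset).1 (h1.and h2)
    obtain ⟨i, hi⟩ := exists_denseTime_mem_Ioo hu
    have h3 := hsub hi
    refine h3.1.trans_le (le_iSup_of_le i ?_)
    rw [if_pos h3.2]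

lemma pathSup_mono {f g : ℝ≥0 → ℝ} {T : ℝ≥0∞} (h : ∀ t, f t ≤ g t) :
    pathSup f T ≤ pathSup g T :=
  iSup₂_mono fun t _ => by exact_mod_cast h t

lemma bot_lt_pathSup (f : ℝ≥0 → ℝ) (T : ℝ≥0∞) : ⊥ < pathSup f T :=
  (EReal.bot_lt_coe (f 0)).trans_le (le_pathSup (by simp))

/-! ### The Markov property at fixed times -/

variable {Ω : Type*} {mΩ : MeasurableSpace Ω} {P : Measure Ω} {𝓕 : Filtration ℝ≥0 mΩ}
  {Y : ℝ≥0 → Ω → ℝ}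

lemma map_restrict_prodMk_of_indep {Ω : Type*} {m mΩ : MeasurableSpace Ω} {P : Measure Ω}
    [IsProbabilityMeasure P] {E : Type*} {mE : MeasurableSpace E} (hm : m ≤ mΩ) {A : Set Ω}
    (hA : MeasurableSet[m] A) {v : Ω → E} (hv : Measurable[m] v) {d : Ω → ℝ} (hd : Measurable d)
    (h : Indep (MeasurableSpace.comap d inferInstance) m P) :
    (P.restrict A).map (fun ω => (v ω, d ω)) = ((P.restrict A).map v).prod (P.map d) := by
  have hv' : Measurable v := hv.mono hm le_rfl
  refine (Measure.prod_eq fun B C hB hC => ?_).symm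
  rw [Measure.map_apply (hv'.prodMk hd) (hB.prod hC), Measure.map_apply hv' hB,
    Measure.map_apply hd hC, Measure.restrict_apply ((hv'.prodMk hd) (hB.prod hC)),
    Measure.restrict_apply (hv' hB)]
  have := (Indep_iff _ _ P).1 h (d ⁻¹' C) (v ⁻¹' B ∩ A) ⟨C, hC, rfl⟩ ((hv hB).inter hA)
  rw [mul_comm, ← this]
  congr 1
  ext ω
  simp only [mem_inter_iff, mem_preimage, mem_prod]
  tauto

lemma IsLevyProcess.measurable (hY : IsLevyProcess P 𝓕 Y) (t : ℝ≥0) : Measurable (Y t) :=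
  (hY.adapted t).mono (𝓕.le t) le_rfl

lemma IsLevyProcess.map_restrict_finset [IsProbabilityMeasure P] (hY : IsLevyProcess P 𝓕 Y)
    (I : Finset ℝ≥0) : ∀ (s : ℝ≥0) {A : Set Ω}, MeasurableSet[𝓕 s] A →
    (P.restrict A).map (fun ω => I.restrict fun t => Y (s + t) ω - Y s ω) =
      P A • P.map (fun ω => I.restrict fun t => Y t ω - Y 0 ω) := by
  induction I using Finset.induction_on_max with
  | empty =>
    intro s A hA
    have h1 : ∀ f g : Ω → ((∅ : Finset ℝ≥0) → ℝ), f = g := fun f g => Subsingleton.elim _ _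
    rw [h1 (fun ω => (∅ : Finset ℝ≥0).restrict fun t => Y (s + t) ω - Y s ω) (fun _ => default),
      h1 (fun ω => (∅ : Finset ℝ≥0).restrict fun t => Y t ω - Y 0 ω) (fun _ => default),
      Measure.map_const, Measure.map_const]
    simp
  | insert a I ha ih =>
    classical
    set b : ℝ≥0 := I.sup id with hb
    have hba : b ≤ a := Finset.sup_le fun x hx => (ha x hx).le
    have haI : a ∉ I := fun h => lt_irrefl a (ha a h)
    -- the values on `insert a I` are a function of those on `I` and of the last increment
    let K : (I → ℝ) × ℝ → (↥(insert a I) → ℝ) := fun p i =>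
      if h : (i : ℝ≥0) ∈ I then p.1 ⟨i, h⟩ else (if hb : b ∈ I then p.1 ⟨b, hb⟩ else 0) + p.2
    have hK : Measurable K := by
      refine measurable_pi_lambda _ fun i => ?_
      by_cases h : (i : ℝ≥0) ∈ I
      · simp only [K, h, dite_true]
        exact (measurable_pi_apply _).comp measurable_fst
      · simp only [K, h, dite_false]
        by_cases hb : b ∈ I
        · simp only [hb, dite_true]
          exact ((measurable_pi_apply _).comp measurable_fst).add measurable_snd
        · simp only [hb, dite_false]
          exact measurable_const.add measurable_snd
    have hKeq : ∀ s : ℝ≥0,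
        (fun ω => (insert a I).restrict fun t => Y (s + t) ω - Y s ω) =
        K ∘ fun ω => (I.restrict (fun t => Y (s + t) ω - Y s ω), Y (s + a) ω - Y (s + b) ω) := by
      intro s
      funext ω i
      obtain ⟨i, hi⟩ := i
      by_cases h : i ∈ I
      · simp [K, h]
      · obtain rfl : i = a := by simpa [h] using hi
        by_cases hbI : b ∈ I
        · simp [K, h, hbI]
        · have hI : I = ∅ := by
            by_contra hne
            obtain ⟨j, hj, hj'⟩ := Finset.exists_mem_eq_sup I
              (Finset.nonempty_iff_ne_empty.2 hne) id
            exact hbI (by rw [hb, hj']; exact hj)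
          have hb0 : b = 0 := by rw [hb, hI]; rfl
          simp [K, h, hb0]
    have hmeas : ∀ s : ℝ≥0, Measurable[𝓕 (s + b)]
        (fun ω => I.restrict fun t => Y (s + t) ω - Y s ω) := by
      intro s
      refine (@measurable_pi_iff Ω I _ (𝓕 (s + b)) _ _).2 fun i => ?_
      have hib : (i : ℝ≥0) ≤ b := Finset.le_sup (f := id) i.2
      exact ((hY.adapted _).mono (𝓕.mono (by gcongr)) le_rfl).sub
        ((hY.adapted s).mono (𝓕.mono le_self_add) le_rfl)
    have key : ∀ (s : ℝ≥0) {A : Set Ω}, MeasurableSet[𝓕 s] A →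
        (P.restrict A).map (fun ω => (insert a I).restrict fun t => Y (s + t) ω - Y s ω) =
        (((P.restrict A).map (fun ω => I.restrict fun t => Y (s + t) ω - Y s ω)).prod
          (P.map fun ω => Y (a - b) ω - Y 0 ω)).map K := by
      intro s A hA
      have hd : Measurable fun ω => Y (s + a) ω - Y (s + b) ω :=
        (hY.measurable _).sub (hY.measurable _)
      have hind := hY.indep_increments (s + b) (s + a) (by gcongr)
      have hlaw := (hY.stationary_increments (s + b) (a - b)).map_eq
      rw [add_assoc, add_tsub_cancel_of_le hba] at hlaw
      rw [hKeq s, ← hlaw, ← map_restrict_prodMk_of_indep (𝓕.le (s + b))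
        (𝓕.mono (le_self_add : s ≤ s + b) _ hA) (hmeas s) hd hind, Measure.map_map hK]
      exact ((hmeas s).mono (𝓕.le _) le_rfl).prodMk hd
    intro s A hA
    have h0 := key 0 (A := univ) MeasurableSet.univ
    simp only [zero_add, Measure.restrict_univ] at h0
    rw [key s hA, ih s hA, h0, Measure.prod_smul_left, Measure.map_smul]

/-- Markov property at a fixed time: the path of increments after time `s` is independent of `𝓕 s`
and has the law of the path of increments after time `0`. -/
lemma IsLevyProcess.map_restrict_path [IsProbabilityMeasure P] (hY : IsLevyProcess P 𝓕 Y)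
    (s : ℝ≥0) {A : Set Ω} (hA : MeasurableSet[𝓕 s] A) :
    (P.restrict A).map (fun ω (t : ℝ≥0) => Y (s + t) ω - Y s ω) =
      P A • P.map (fun ω (t : ℝ≥0) => Y t ω - Y 0 ω) := by
  have h1 : ∀ s : ℝ≥0, Measurable fun ω (t : ℝ≥0) => Y (s + t) ω - Y s ω := fun s =>
    measurable_pi_lambda _ fun t => (hY.measurable _).sub (hY.measurable _)
  have h2 : Measurable fun ω (t : ℝ≥0) => Y t ω - Y 0 ω :=
    measurable_pi_lambda _ fun t => (hY.measurable _).sub (hY.measurable _)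
  have h3 := isProjectiveLimit_map (P := P.restrict A)
    (X := fun (t : ℝ≥0) ω => Y (s + t) ω - Y s ω) (h1 s).aemeasurable
  have h4 : IsProjectiveLimit (P A • P.map (fun ω (t : ℝ≥0) => Y t ω - Y 0 ω))
      (fun I => (P.restrict A).map (fun ω => I.restrict fun t => Y (s + t) ω - Y s ω)) := by
    intro I
    beta_reduce
    rw [Measure.map_smul, hY.map_restrict_finset I s hA,
      isProjectiveLimit_map (X := fun (t : ℝ≥0) ω => Y t ω - Y 0 ω) h2.aemeasurable I]
  have : ∀ I : Finset ℝ≥0, IsFiniteMeasure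
      ((P.restrict A).map (fun ω => I.restrict fun t => Y (s + t) ω - Y s ω)) := fun I => by
    infer_instance
  exact h3.unique h4

/-! ### The strong Markov property -/

/-- A Lévy process all of whose paths (not only almost all) start from `0` and are
right-continuous. Left limits play no role in the argument. -/
structure IsRegularLevyProcess (P : Measure Ω) (𝓕 : Filtration ℝ≥0 mΩ) (Y : ℝ≥0 → Ω → ℝ) :
    Prop extends IsLevyProcess P 𝓕 Y where
  zero_apply : ∀ ω, Y 0 ω = 0
  rightCont : ∀ ω t, ContinuousWithinAt (fun t => Y t ω) (Ici t) t

/-- The first point strictly after `t` of the grid of mesh `1 / (k + 1)`. -/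
noncomputable def nextGrid (k : ℕ) (t : ℝ≥0) : ℝ≥0 := ((⌊(k + 1 : ℝ≥0) * t⌋₊ : ℝ≥0) + 1) / (k + 1)

lemma lt_nextGrid (k : ℕ) (t : ℝ≥0) : t < nextGrid k t := by
  rw [nextGrid, lt_div_iff₀ (by positivity), mul_comm]
  exact Nat.lt_floor_add_one _

lemma nextGrid_le (k : ℕ) (t : ℝ≥0) : nextGrid k t ≤ t + 1 / (k + 1) := by
  rw [nextGrid, add_div]
  gcongr
  rw [div_le_iff₀ (by positivity), mul_comm]
  exact Nat.floor_le (by positivity)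

lemma tendsto_nextGrid (t : ℝ≥0) : Tendsto (fun k => nextGrid k t) atTop (𝓝[≥] t) := by
  refine tendsto_nhdsWithin_iff.2 ⟨?_, Eventually.of_forall fun k => (lt_nextGrid k t).le⟩
  refine tendsto_of_tendsto_of_tendsto_of_le_of_le tendsto_const_nhds ?_
    (fun k => (lt_nextGrid k t).le) (fun k => nextGrid_le k t)
  have h : Tendsto (fun k : ℕ => 1 / ((k : ℝ≥0) + 1)) atTop (𝓝 0) :=
    tendsto_one_div_add_atTop_nhds_zero_nat
  simpa using h.const_add t

lemma measurable_uncurry_of_rightCont {Z : ℝ≥0 → Ω → ℝ} (hZ : ∀ t, Measurable (Z t))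
    (hrc : ∀ ω t, ContinuousWithinAt (fun t => Z t ω) (Ici t) t) :
    Measurable fun p : ℝ≥0 × Ω => Z p.1 p.2 := by
  refine measurable_of_tendsto_metrizable (f := fun k p => Z (nextGrid k p.1) p.2) (fun k => ?_)
    (tendsto_pi_nhds.2 fun p => ?_)
  · have key : ∀ (u : ℕ → ℝ≥0) (n : ℝ≥0 → ℕ), Measurable n →
        Measurable fun p : ℝ≥0 × Ω => Z (u (n p.1)) p.2 := fun u n hn =>
      (measurable_from_prod_countable_right (f := fun q : ℕ × Ω => Z (u q.1) q.2)
        fun j => hZ (u j)).comp ((hn.comp measurable_fst).prodMk measurable_snd)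
    exact key (fun j => ((j : ℝ≥0) + 1) / (k + 1)) (fun t => ⌊(k + 1 : ℝ≥0) * t⌋₊)
      (Nat.measurable_floor.comp (measurable_const.mul measurable_id))
  · exact (hrc p.2 p.1).tendsto.comp (tendsto_nextGrid p.1)

/-- The path of increments after the time `s`, sampled along `denseTime`. -/
noncomputable def shiftedPath (Y : ℝ≥0 → Ω → ℝ) (s : ℝ≥0) (ω : Ω) : ℕ → ℝ :=
  fun i => Y (s + denseTime i) ω - Y s ω

/-- The law of the process, sampled along `denseTime`. -/
noncomputable def pathLaw (P : Measure Ω) (Y : ℝ≥0 → Ω → ℝ) : Measure (ℕ → ℝ) :=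
  P.map fun ω i => Y (denseTime i) ω

namespace IsRegularLevyProcess

lemma measurable_path (hY : IsRegularLevyProcess P 𝓕 Y) :
    Measurable fun ω i => Y (denseTime i) ω :=
  measurable_pi_lambda _ fun _ => hY.measurable _

lemma isProbabilityMeasure_pathLaw [IsProbabilityMeasure P] (hY : IsRegularLevyProcess P 𝓕 Y) :
    IsProbabilityMeasure (pathLaw P Y) :=
  Measure.isProbabilityMeasure_map hY.measurable_path.aemeasurable

lemma measurable_uncurry (hY : IsRegularLevyProcess P 𝓕 Y) :
    Measurable fun p : ℝ≥0 × Ω => Y p.1 p.2 :=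
  measurable_uncurry_of_rightCont hY.measurable hY.rightCont

lemma measurable_apply (hY : IsRegularLevyProcess P 𝓕 Y) {σ : Ω → ℝ≥0} (hσ : Measurable σ) :
    Measurable fun ω => Y (σ ω) ω :=
  hY.measurable_uncurry.comp (hσ.prodMk measurable_id)

lemma measurable_shiftedPath (hY : IsRegularLevyProcess P 𝓕 Y) {σ : Ω → ℝ≥0}
    (hσ : Measurable σ) : Measurable fun ω => shiftedPath Y (σ ω) ω :=
  measurable_pi_lambda _ fun _ =>
    (hY.measurable_apply (hσ.add measurable_const)).sub (hY.measurable_apply hσ)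

lemma map_restrict_shiftedPath [IsProbabilityMeasure P] (hY : IsRegularLevyProcess P 𝓕 Y)
    (s : ℝ≥0) {A : Set Ω} (hA : MeasurableSet[𝓕 s] A) :
    (P.restrict A).map (shiftedPath Y s) = P A • pathLaw P Y := by
  have h := congrArg (Measure.map fun (y : ℝ≥0 → ℝ) i => y (denseTime i))
    (hY.map_restrict_path s hA)
  have h1 : Measurable fun (y : ℝ≥0 → ℝ) (i : ℕ) => y (denseTime i) :=
    measurable_pi_lambda _ fun i => measurable_pi_apply _
  rw [Measure.map_smul, Measure.map_map h1, Measure.map_map h1] at h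
  · simp only [Function.comp_def, hY.zero_apply, sub_zero] at h
    exact h
  · exact measurable_pi_lambda _ fun t => (hY.measurable _).sub (hY.measurable _)
  · exact measurable_pi_lambda _ fun t => (hY.measurable _).sub (hY.measurable _)

lemma indep_shiftedPath [IsProbabilityMeasure P] (hY : IsRegularLevyProcess P 𝓕 Y) (s : ℝ≥0) :
    Indep (𝓕 s) (MeasurableSpace.comap (shiftedPath Y s) inferInstance) P := by
  have hm : Measurable (shiftedPath Y s) := hY.measurable_shiftedPath measurable_const
  rw [Indep_iff]
  rintro A' _ hA' ⟨B, hB, rfl⟩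
  have hu := congrArg (fun μ => μ B)
    (hY.map_restrict_shiftedPath s (A := univ) MeasurableSet.univ)
  have h2 := congrArg (fun μ => μ B) (hY.map_restrict_shiftedPath s hA')
  simp only [Measure.restrict_univ, measure_univ, one_smul] at hu
  simp only [Measure.smul_apply, smul_eq_mul] at h2
  rw [← hu, Measure.map_apply hm hB, Measure.map_apply hm hB,
    Measure.restrict_apply (hm hB)] at h2
  rw [inter_comm, h2]

lemma indepFun_shiftedPath [IsProbabilityMeasure P] (hY : IsRegularLevyProcess P 𝓕 Y) (s : ℝ≥0)
    {E E' : Type*} {mE : MeasurableSpace E} {mE' : MeasurableSpace E'} {f : Ω → E}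
    (hf : Measurable[𝓕 s] f) {h : (ℕ → ℝ) → E'} (hh : Measurable h) :
    IndepFun f (fun ω => h (shiftedPath Y s ω)) P := by
  rw [IndepFun_iff_Indep]
  refine indep_of_indep_of_le_left (indep_of_indep_of_le_right (hY.indep_shiftedPath s) ?_)
    hf.comap_le
  rw [show (fun ω => h (shiftedPath Y s ω)) = h ∘ shiftedPath Y s from rfl,
    ← MeasurableSpace.comap_comp]
  exact MeasurableSpace.comap_mono hh.comap_le

lemma map_shiftedPath [IsProbabilityMeasure P] (hY : IsRegularLevyProcess P 𝓕 Y) (s : ℝ≥0) :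
    P.map (shiftedPath Y s) = pathLaw P Y := by
  simpa using hY.map_restrict_shiftedPath s (A := univ) MeasurableSet.univ

lemma setIntegral_mul_shiftedPath [IsProbabilityMeasure P] (hY : IsRegularLevyProcess P 𝓕 Y)
    (s : ℝ≥0) {A : Set Ω} (hA : MeasurableSet[𝓕 s] A) {f : Ω → ℝ} (hf : Measurable[𝓕 s] f)
    {h : (ℕ → ℝ) → ℝ} (hh : Measurable h) :
    ∫ ω in A, f ω * h (shiftedPath Y s ω) ∂P = (∫ ω in A, f ω ∂P) * ∫ y, h y ∂pathLaw P Y := by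
  have hm : Measurable (shiftedPath Y s) := hY.measurable_shiftedPath measurable_const
  have hind : IndepFun (A.indicator f) (fun ω => h (shiftedPath Y s ω)) P :=
    hY.indepFun_shiftedPath s (hf.indicator hA) hh
  have hA' := 𝓕.le s _ hA
  have hf' := hf.mono (𝓕.le s) le_rfl
  have := hind.integral_fun_mul_eq_mul_integral
    (hf'.indicator hA').aestronglyMeasurable (hh.comp hm).aestronglyMeasurable
  rw [← integral_indicator hA', ← integral_indicator hA']
  rw [← hY.map_shiftedPath s, integral_map hm.aemeasurable hh.aestronglyMeasurable, ← this]
  congr 1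
  funext ω
  by_cases hω : ω ∈ A <;> simp [hω]

lemma measurable_untopD {τ : Ω → WithTop ℝ≥0} (hτ : IsStoppingTime 𝓕 τ) :
    Measurable fun ω => (τ ω).untopD 0 := by
  refine measurable_of_Ici fun a => ?_
  by_cases ha : a = 0
  · simp [ha]
  have : (fun ω => (τ ω).untopD 0) ⁻¹' Ici a = {ω | (a : WithTop ℝ≥0) ≤ τ ω} ∩ {ω | τ ω = ⊤}ᶜ := by
    ext ω
    simp only [mem_preimage, mem_Ici, mem_inter_iff, mem_ofPred_eq, mem_compl_iff]
    cases h : τ ω with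
    | top => simpa only [WithTop.untopD_top, nonpos_iff_eq_zero, not_true, and_false, iff_false]
    | coe b => simp only [WithTop.untopD_coe, WithTop.coe_le_coe, WithTop.coe_ne_top,
        not_false_eq_true, and_true]
  rw [this]
  exact ((𝓕.le a) _ (hτ.measurableSet_ge a)).inter hτ.measurableSet_eq_top.compl

/-- The strong Markov property for bounded continuous test functions. The default value `0` given to
the stopping time on `{τ = ∞}` plays no role, as the integrals are over `{τ < ∞}`. -/
lemma strongMarkov_boundedContinuous [IsProbabilityMeasure P] (hY : IsRegularLevyProcess P 𝓕 Y)
    {τ : Ω → WithTop ℝ≥0} (hτ : IsStoppingTime 𝓕 τ) (f : BoundedContinuousFunction (ℝ≥0 × ℝ) ℝ)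
    (h : BoundedContinuousFunction (ℕ → ℝ) ℝ) :
    ∫ ω in {ω | τ ω ≠ ⊤}, f ((τ ω).untopD 0, Y ((τ ω).untopD 0) ω) *
        h (shiftedPath Y ((τ ω).untopD 0) ω) ∂P =
      (∫ ω in {ω | τ ω ≠ ⊤}, f ((τ ω).untopD 0, Y ((τ ω).untopD 0) ω) ∂P) *
        ∫ y, h y ∂pathLaw P Y := by
  set σ : Ω → ℝ≥0 := fun ω => (τ ω).untopD 0 with hσ
  have hσm : Measurable σ := measurable_untopD hτ
  have hgm : ∀ k, Measurable fun ω => nextGrid k (σ ω) := fun k => by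
    unfold nextGrid
    fun_prop
  have hA : MeasurableSet {ω | τ ω ≠ ⊤} := hτ.measurableSet_eq_top.compl
  -- the identity holds for the times `nextGrid k σ`, which take countably many values
  have hk : ∀ k : ℕ, ∫ ω in {ω | τ ω ≠ ⊤}, f (nextGrid k (σ ω), Y (nextGrid k (σ ω)) ω) *
        h (shiftedPath Y (nextGrid k (σ ω)) ω) ∂P =
      (∫ ω in {ω | τ ω ≠ ⊤}, f (nextGrid k (σ ω), Y (nextGrid k (σ ω)) ω) ∂P) *
        ∫ y, h y ∂pathLaw P Y := by
    intro k
    let u : ℕ → ℝ≥0 := fun j => ((j : ℝ≥0) + 1) / (k + 1)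
    let A : ℕ → Set Ω := fun j => {ω | τ ω ≠ ⊤ ∧ ⌊(k + 1 : ℝ≥0) * σ ω⌋₊ = j}
    have hAF : ∀ j, MeasurableSet[𝓕 (u j)] (A j) := by
      intro j
      have : A j = {ω | ((j / (k + 1) : ℝ≥0) : WithTop ℝ≥0) ≤ τ ω} ∩
          {ω | τ ω < ((u j : ℝ≥0) : WithTop ℝ≥0)} := by
        ext ω
        simp only [A, u, σ, mem_ofPred_eq, mem_inter_iff]
        cases hω : τ ω with
        | top => simp only [ne_eq, not_true, false_and, not_top_lt, and_false]
        | coe b =>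
          simp only [ne_eq, WithTop.coe_ne_top, not_false_eq_true, WithTop.untopD_coe, true_and,
            WithTop.coe_le_coe, WithTop.coe_lt_coe]
          rw [Nat.floor_eq_iff (by positivity), div_le_iff₀ (by positivity),
            lt_div_iff₀ (by positivity), mul_comm b]
      rw [this]
      have hle : (j / (k + 1) : ℝ≥0) ≤ u j := by simp only [u]; gcongr; exact le_self_add
      exact (𝓕.mono hle _ (hτ.measurableSet_ge _)).inter (hτ.measurableSet_lt _)
    have hAU : {ω | τ ω ≠ ⊤} = ⋃ j, A j := by
      ext ω; simp [A]
    have hAd : Pairwise (Function.onFun Disjoint A) := by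
      intro i j hij
      refine Set.disjoint_left.2 fun ω hi hj => hij ?_
      exact hi.2.symm.trans hj.2
    have hAm : ∀ j, MeasurableSet (A j) := fun j => 𝓕.le _ _ (hAF j)
    have hgA : ∀ j, ∀ ω ∈ A j, nextGrid k (σ ω) = u j := by
      intro j ω hω
      simp only [nextGrid, u, hω.2]
    have hfm : Measurable fun ω => f (nextGrid k (σ ω), Y (nextGrid k (σ ω)) ω) :=
      f.continuous.measurable.comp ((hgm k).prodMk (hY.measurable_apply (hgm k)))
    have hhm : Measurable fun ω => h (shiftedPath Y (nextGrid k (σ ω)) ω) :=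
      h.continuous.measurable.comp (hY.measurable_shiftedPath (hgm k))
    have hfi : Integrable (fun ω => f (nextGrid k (σ ω), Y (nextGrid k (σ ω)) ω)) P :=
      Integrable.of_bound hfm.aestronglyMeasurable ‖f‖ (ae_of_all _ fun ω => f.norm_coe_le_norm _)
    have hfhi : Integrable (fun ω => f (nextGrid k (σ ω), Y (nextGrid k (σ ω)) ω) *
        h (shiftedPath Y (nextGrid k (σ ω)) ω)) P :=
      hfi.mul_bdd (c := ‖h‖) hhm.aestronglyMeasurable (ae_of_all _ fun ω => h.norm_coe_le_norm _)
    rw [hAU, integral_iUnion hAm hAd hfhi.integrableOn, integral_iUnion hAm hAd hfi.integrableOn,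
      ← tsum_mul_right]
    refine tsum_congr fun j => ?_
    have e1 : ∫ ω in A j, f (nextGrid k (σ ω), Y (nextGrid k (σ ω)) ω) *
        h (shiftedPath Y (nextGrid k (σ ω)) ω) ∂P =
        ∫ ω in A j, f (u j, Y (u j) ω) * h (shiftedPath Y (u j) ω) ∂P :=
      setIntegral_congr_fun (hAm j) fun ω hω => by simp only [hgA j ω hω]
    have e2 : ∫ ω in A j, f (nextGrid k (σ ω), Y (nextGrid k (σ ω)) ω) ∂P =
        ∫ ω in A j, f (u j, Y (u j) ω) ∂P :=
      setIntegral_congr_fun (hAm j) fun ω hω => by simp only [hgA j ω hω]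
    rw [e1, e2]
    refine hY.setIntegral_mul_shiftedPath (u j) (hAF j) ?_ h.continuous.measurable
    exact f.continuous.measurable.comp (measurable_const.prodMk (hY.adapted _))
  -- right-continuity lets the grid be refined
  have htY : ∀ ω t, Tendsto (fun k => Y (nextGrid k t) ω) atTop (𝓝 (Y t ω)) := fun ω t =>
    (hY.rightCont ω t).tendsto.comp (tendsto_nextGrid t)
  have htf : ∀ ω, Tendsto (fun k => f (nextGrid k (σ ω), Y (nextGrid k (σ ω)) ω)) atTop
      (𝓝 (f (σ ω, Y (σ ω) ω))) := fun ω =>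
    (f.continuous.tendsto _).comp
      ((tendsto_nhdsWithin_iff.1 (tendsto_nextGrid (σ ω))).1.prodMk_nhds (htY ω _))
  have hth : ∀ ω, Tendsto (fun k => h (shiftedPath Y (nextGrid k (σ ω)) ω)) atTop
      (𝓝 (h (shiftedPath Y (σ ω) ω))) := by
    intro ω
    refine (h.continuous.tendsto _).comp (tendsto_pi_nhds.2 fun i => ?_)
    refine Tendsto.sub ?_ (htY ω _)
    refine (hY.rightCont ω (σ ω + denseTime i)).tendsto.comp ?_
    refine tendsto_nhdsWithin_iff.2 ⟨?_, Eventually.of_forall fun k =>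
      add_le_add_left (lt_nextGrid k _).le _⟩
    exact (tendsto_nhdsWithin_iff.1 (tendsto_nextGrid (σ ω))).1.add_const _
  have hfm : ∀ k, Measurable fun ω => f (nextGrid k (σ ω), Y (nextGrid k (σ ω)) ω) := fun k =>
      f.continuous.measurable.comp ((hgm k).prodMk (hY.measurable_apply (hgm k)))
  have hhm : ∀ k, Measurable fun ω => h (shiftedPath Y (nextGrid k (σ ω)) ω) := fun k =>
      h.continuous.measurable.comp (hY.measurable_shiftedPath (hgm k))
  have l1 : Tendsto (fun k => ∫ ω in {ω | τ ω ≠ ⊤}, f (nextGrid k (σ ω), Y (nextGrid k (σ ω)) ω) *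
        h (shiftedPath Y (nextGrid k (σ ω)) ω) ∂P) atTop
      (𝓝 (∫ ω in {ω | τ ω ≠ ⊤}, f (σ ω, Y (σ ω) ω) * h (shiftedPath Y (σ ω) ω) ∂P)) := by
    refine tendsto_integral_of_dominated_convergence (fun _ => ‖f‖ * ‖h‖)
      (fun k => ((hfm k).mul (hhm k)).aestronglyMeasurable) (integrable_const _) (fun k => ?_)
      (ae_of_all _ fun ω => (htf ω).mul (hth ω))
    refine ae_of_all _ fun ω => ?_
    rw [norm_mul]
    exact mul_le_mul (f.norm_coe_le_norm _) (h.norm_coe_le_norm _) (norm_nonneg _) (norm_nonneg _)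
  have l2 : Tendsto (fun k => ∫ ω in {ω | τ ω ≠ ⊤},
        f (nextGrid k (σ ω), Y (nextGrid k (σ ω)) ω) ∂P) atTop
      (𝓝 (∫ ω in {ω | τ ω ≠ ⊤}, f (σ ω, Y (σ ω) ω) ∂P)) :=
    tendsto_integral_of_dominated_convergence (fun _ => ‖f‖)
      (fun k => (hfm k).aestronglyMeasurable) (integrable_const _)
      (fun k => ae_of_all _ fun ω => f.norm_coe_le_norm _) (ae_of_all _ htf)
  simp only [hk] at l1
  exact tendsto_nhds_unique l1 (l2.mul_const _)

/-- **Strong Markov property**: on `{τ < ∞}` the path of increments after `τ` is independent of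
`(τ, Y_τ)` and has the law of `Y`. -/
lemma strongMarkov [IsProbabilityMeasure P] (hY : IsRegularLevyProcess P 𝓕 Y)
    {τ : Ω → WithTop ℝ≥0} (hτ : IsStoppingTime 𝓕 τ) :
    (P.restrict {ω | τ ω ≠ ⊤}).map (fun ω => (((τ ω).untopD 0, Y ((τ ω).untopD 0) ω),
        shiftedPath Y ((τ ω).untopD 0) ω)) =
      ((P.restrict {ω | τ ω ≠ ⊤}).map fun ω => ((τ ω).untopD 0, Y ((τ ω).untopD 0) ω)).prod
        (pathLaw P Y) := by
  have := hY.isProbabilityMeasure_pathLaw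
  have hσm := measurable_untopD hτ
  have h1 := hσm.prodMk (hY.measurable_apply hσm)
  have h2 := h1.prodMk (hY.measurable_shiftedPath hσm)
  refine Measure.eq_prod_of_integral_mul_boundedContinuousFunction fun f h => ?_
  rw [integral_map h2.aemeasurable, integral_map h1.aemeasurable]
  · exact hY.strongMarkov_boundedContinuous hτ f h
  · exact f.continuous.measurable.aestronglyMeasurable
  · exact ((f.continuous.measurable.comp measurable_fst).mul
      (h.continuous.measurable.comp measurable_snd)).aestronglyMeasurable

end IsRegularLevyProcess

/-! ### The exponential horizon -/

lemma isProbabilityMeasure_horizonLaw {r : ℝ} (hr : 0 ≤ r) :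
    IsProbabilityMeasure (horizonLaw r) := by
  unfold horizonLaw
  split_ifs with h
  · infer_instance
  · have := isProbabilityMeasure_gammaMeasure one_pos (lt_of_le_of_ne hr (Ne.symm h))
    exact Measure.isProbabilityMeasure_map
      (μ := gammaMeasure 1 r) ENNReal.measurable_ofReal.aemeasurable

lemma lintegral_horizonLaw {r : ℝ} (hr : r ≠ 0) {h : ℝ≥0∞ → ℝ≥0∞} (hh : Measurable h) :
    ∫⁻ T, h T ∂horizonLaw r = ∫⁻ t : ℝ, exponentialPDF r t * h (ENNReal.ofReal t) := by
  rw [horizonLaw, if_neg hr, lintegral_map hh ENNReal.measurable_ofReal]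
  have : expMeasure r = volume.withDensity (exponentialPDF r) := rfl
  rw [this]
  exact lintegral_withDensity_eq_lintegral_mul _
    (measurable_exponentialPDFReal r).ennreal_ofReal (hh.comp ENNReal.measurable_ofReal)

/-- Lack of memory of the exponential time (trivial when the horizon is infinite). -/
lemma exp_mul_lintegral_horizonLaw {r : ℝ} (a : ℝ≥0) {h : ℝ≥0∞ → ℝ≥0∞}
    (hh : Measurable h) :
    ENNReal.ofReal (Real.exp (-r * a)) * ∫⁻ T, h T ∂horizonLaw r =
      ∫⁻ T, (if (a : ℝ≥0∞) ≤ T then h (T - a) else 0) ∂horizonLaw r := by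
  have hm : Measurable fun T : ℝ≥0∞ => if (a : ℝ≥0∞) ≤ T then h (T - a) else 0 :=
    Measurable.ite measurableSet_Ici (hh.comp (measurable_id.sub_const _)) measurable_const
  by_cases h0 : r = 0
  · subst h0
    rw [horizonLaw, if_pos rfl, lintegral_dirac' _ hh, lintegral_dirac' _ hm]
    simp
  rw [lintegral_horizonLaw h0 hh, lintegral_horizonLaw h0 hm,
    ← lintegral_add_right_eq_self (μ := volume) (fun t : ℝ => exponentialPDF r t *
      (if (a : ℝ≥0∞) ≤ ENNReal.ofReal t then h (ENNReal.ofReal t - a) else 0)) (a : ℝ),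
    ← lintegral_const_mul']
  · refine lintegral_congr fun t => ?_
    rcases le_or_gt 0 t with ht | ht
    · have h1 : ENNReal.ofReal (t + a) = ENNReal.ofReal t + a := by
        rw [ENNReal.ofReal_add ht a.coe_nonneg, ENNReal.ofReal_coe_nnreal]
      rw [exponentialPDF_of_nonneg ht, exponentialPDF_of_nonneg (add_nonneg ht a.coe_nonneg), h1,
        if_pos le_add_self, ENNReal.add_sub_cancel_right ENNReal.coe_ne_top, ← mul_assoc,
        ← ENNReal.ofReal_mul (Real.exp_nonneg _)]
      congr 2
      rw [mul_left_comm, ← Real.exp_add]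
      congr 2
      ring
    · rw [exponentialPDF_of_neg ht, zero_mul, mul_zero]
      by_cases ha : a = 0
      · subst ha
        simp [exponentialPDF_of_neg ht]
      · rw [if_neg, mul_zero]
        rw [not_le, ← ENNReal.ofReal_coe_nnreal]
        exact (ENNReal.ofReal_lt_ofReal_iff (NNReal.coe_pos.2 (pos_iff_ne_zero.2 ha))).2
          (by linarith)
  · exact ENNReal.ofReal_ne_top

lemma ae_lt_top_horizonLaw {r : ℝ} (hr : 0 < r) : ∀ᵐ T ∂horizonLaw r, T < ⊤ := by
  rw [horizonLaw, if_neg hr.ne',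
    ae_map_iff ENNReal.measurable_ofReal.aemeasurable measurableSet_Iio]
  exact ae_of_all _ fun t => ENNReal.ofReal_lt_top

/-- The event `τ < ∞`, `τ ≤ e(r)` in the extended space. -/
def reached (τ : Ω → WithTop ℝ≥0) : Set (Ω × ℝ≥0∞) :=
  {p | τ p.1 ≠ ⊤ ∧ (((τ p.1).untopD 0 : ℝ≥0) : ℝ≥0∞) ≤ p.2}

lemma measurableSet_reached {τ : Ω → WithTop ℝ≥0} (hτ : IsStoppingTime 𝓕 τ) :
    MeasurableSet (reached τ) := by
  refine MeasurableSet.inter (s₁ := {p : Ω × ℝ≥0∞ | τ p.1 ≠ ⊤}) ?_ ?_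
  · exact hτ.measurableSet_eq_top.compl.preimage measurable_fst
  · exact measurableSet_le ((IsRegularLevyProcess.measurable_untopD hτ).comp
      measurable_fst).coe_nnreal_ennreal measurable_snd

namespace IsRegularLevyProcess

/-- The strong Markov property combined with the lack of memory of the horizon, for an arbitrary
functional `K` of the present state, the future increments and the remaining horizon. -/
lemma lintegral_strongMarkov [IsProbabilityMeasure P] (hY : IsRegularLevyProcess P 𝓕 Y)
    {r : ℝ} (hr : 0 ≤ r) {τ : Ω → WithTop ℝ≥0} (hτ : IsStoppingTime 𝓕 τ)
    {K : ℝ × ((ℕ → ℝ) × ℝ≥0∞) → ℝ≥0∞} (hK : Measurable K) :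
    ∫⁻ ω in {ω | τ ω ≠ ⊤}, ENNReal.ofReal (Real.exp (-r * (τ ω).untopD 0)) *
        (∫⁻ p, K (Y ((τ ω).untopD 0) ω, (fun i => Y (denseTime i) p.1, p.2)) ∂extendedLaw P r) ∂P =
      ∫⁻ p in reached τ, K (Y ((τ p.1).untopD 0) p.1,
        (shiftedPath Y ((τ p.1).untopD 0) p.1, p.2 - ((τ p.1).untopD 0 : ℝ≥0)))
          ∂extendedLaw P r := by
  have := isProbabilityMeasure_horizonLaw hr
  have := hY.isProbabilityMeasure_pathLaw
  have hσm := measurable_untopD hτ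
  have hA : MeasurableSet {ω | τ ω ≠ ⊤} := hτ.measurableSet_eq_top.compl
  let J' : ((ℝ≥0 × ℝ) × (ℕ → ℝ)) × ℝ≥0∞ → ℝ≥0∞ := fun q =>
    if (q.1.1.1 : ℝ≥0∞) ≤ q.2 then K (q.1.1.2, (q.1.2, q.2 - q.1.1.1)) else 0
  have hJ' : Measurable J' := by
    refine Measurable.ite (measurableSet_le (by fun_prop) (by fun_prop)) (hK.comp ?_)
      measurable_const
    fun_prop
  let J : (ℝ≥0 × ℝ) × (ℕ → ℝ) → ℝ≥0∞ := fun q => ∫⁻ T, J' (q, T) ∂horizonLaw r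
  have hJ : Measurable J := hJ'.lintegral_prod_right'
  have h1 := hσm.prodMk (hY.measurable_apply hσm)
  have h2 := h1.prodMk (hY.measurable_shiftedPath hσm)
  have e1 : ∀ ω, ENNReal.ofReal (Real.exp (-r * (τ ω).untopD 0)) *
        (∫⁻ p, K (Y ((τ ω).untopD 0) ω, (fun i => Y (denseTime i) p.1, p.2)) ∂extendedLaw P r) =
      ∫⁻ y, J (((τ ω).untopD 0, Y ((τ ω).untopD 0) ω), y) ∂pathLaw P Y := by
    intro ω
    have hKm : Measurable fun p : Ω × ℝ≥0∞ =>
        K (Y ((τ ω).untopD 0) ω, (fun i => Y (denseTime i) p.1, p.2)) :=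
      hK.comp (measurable_const.prodMk
        ((hY.measurable_path.comp measurable_fst).prodMk measurable_snd))
    have hJω : Measurable fun y => J (((τ ω).untopD 0, Y ((τ ω).untopD 0) ω), y) :=
      hJ.comp (measurable_const.prodMk measurable_id)
    rw [extendedLaw, lintegral_prod _ hKm.aemeasurable, pathLaw,
      lintegral_map hJω hY.measurable_path, ← lintegral_const_mul' _ _ ENNReal.ofReal_ne_top]
    refine lintegral_congr fun ω' => ?_
    exact exp_mul_lintegral_horizonLaw _
      (h := fun T => K (Y ((τ ω).untopD 0) ω, (fun i => Y (denseTime i) ω', T)))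
      (hK.comp (measurable_const.prodMk (measurable_const.prodMk measurable_id)))
  simp only [e1]
  have e2 : ∫⁻ ω in {ω | τ ω ≠ ⊤}, ∫⁻ y, J (((τ ω).untopD 0, Y ((τ ω).untopD 0) ω), y)
        ∂pathLaw P Y ∂P =
      ∫⁻ ω in {ω | τ ω ≠ ⊤}, J (((τ ω).untopD 0, Y ((τ ω).untopD 0) ω),
        shiftedPath Y ((τ ω).untopD 0) ω) ∂P := by
    rw [← lintegral_map (f := J) hJ h2, hY.strongMarkov hτ, lintegral_prod _ hJ.aemeasurable,
      lintegral_map hJ.lintegral_prod_right' h1]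
  have hg : Measurable fun p : Ω × ℝ≥0∞ => K (Y ((τ p.1).untopD 0) p.1,
        (shiftedPath Y ((τ p.1).untopD 0) p.1, p.2 - ((τ p.1).untopD 0 : ℝ≥0))) := by
    refine hK.comp (Measurable.prodMk ((hY.measurable_apply hσm).comp measurable_fst)
      (Measurable.prodMk ((hY.measurable_shiftedPath hσm).comp measurable_fst) ?_))
    exact measurable_snd.sub (hσm.comp measurable_fst).coe_nnreal_ennreal
  rw [e2, ← lintegral_indicator (measurableSet_reached hτ), extendedLaw,
    lintegral_prod _ (hg.indicator (measurableSet_reached hτ)).aemeasurable,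
    ← lintegral_indicator hA]
  refine lintegral_congr fun ω => ?_
  by_cases hω : τ ω = ⊤
  · simp [hω, reached, indicator]
  · rw [indicator_of_mem (by exact hω)]
    refine lintegral_congr fun T => ?_
    by_cases hT : (((τ ω).untopD 0 : ℝ≥0) : ℝ≥0∞) ≤ T
    · have hmem : (ω, T) ∈ reached τ := ⟨hω, hT⟩
      rw [indicator_of_mem hmem]
      exact if_pos hT
    · have hmem : (ω, T) ∉ reached τ := fun h => hT h.2
      rw [indicator_of_notMem hmem]
      exact if_neg hT

/-- Measurability of the running supremum in the sample point and the horizon. -/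
lemma measurable_pathSup (hY : IsRegularLevyProcess P 𝓕 Y) (x : ℝ) :
    Measurable fun p : Ω × ℝ≥0∞ => pathSup (fun t => startedAt Y x t p.1) p.2 := by
  have h : Measurable fun p : Ω × ℝ≥0∞ =>
      supFunctional (fun i => x + Y (denseTime i) p.1) p.2 := by
    refine measurable_supFunctional ?_ measurable_snd
    exact measurable_pi_lambda _ fun i =>
      measurable_const.add ((hY.measurable _).comp measurable_fst)
  have heq : (fun p : Ω × ℝ≥0∞ => pathSup (fun t => startedAt Y x t p.1) p.2) =
      fun p => supFunctional (fun i => x + Y (denseTime i) p.1) p.2 := funext fun p =>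
    (supFunctional_comp_denseTime (f := fun t => x + Y t p.1)
      (fun t => continuousWithinAt_const.add (hY.rightCont p.1 t)) p.2).symm
  rw [heq]
  exact h

lemma rightCont_add (hY : IsRegularLevyProcess P 𝓕 Y) (ω : Ω) (s t : ℝ≥0) :
    ContinuousWithinAt (fun t => Y (s + t) ω) (Ici t) t := by
  refine (hY.rightCont ω (s + t)).comp (continuous_const_add s).continuousWithinAt ?_
  exact fun u hu => add_le_add_right (α := ℝ≥0) hu s

/-- Strong Markov property for the supremum after a stopping time: with `V x = E_x Ψ(M)`,
`E e^{-rτ} V(X_τ) 1_{τ < ∞}` is the mean of `Ψ(sup_{τ ≤ t ≤ e(r)} X_t)` on `{τ ≤ e(r)}`. -/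
lemma lintegral_exp_mul_valueAt [IsProbabilityMeasure P] (hY : IsRegularLevyProcess P 𝓕 Y)
    {r : ℝ} (hr : 0 ≤ r) {τ : Ω → WithTop ℝ≥0} (hτ : IsStoppingTime 𝓕 τ)
    {Ψ : EReal → ℝ≥0∞} (hΨ : Measurable Ψ) (x : ℝ) :
    ∫⁻ ω in {ω | τ ω ≠ ⊤}, ENNReal.ofReal (Real.exp (-r * (τ ω).untopD 0)) *
        (∫⁻ p, Ψ (pathSup (fun t => startedAt Y (startedAt Y x ((τ ω).untopD 0) ω) t p.1) p.2)
          ∂extendedLaw P r) ∂P =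
      ∫⁻ p in reached τ, Ψ (pathSup (fun t => startedAt Y x ((τ p.1).untopD 0 + t) p.1)
        (p.2 - ((τ p.1).untopD 0 : ℝ≥0))) ∂extendedLaw P r := by
  have hK : Measurable fun q : ℝ × ((ℕ → ℝ) × ℝ≥0∞) =>
      Ψ (supFunctional (fun i => x + q.1 + q.2.1 i) q.2.2) := by
    have hu : Measurable fun (q : ℝ × ((ℕ → ℝ) × ℝ≥0∞)) i => x + q.1 + q.2.1 i :=
      measurable_pi_lambda _ fun i => by fun_prop
    exact hΨ.comp (measurable_supFunctional hu measurable_snd.snd)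
  refine Eq.trans (lintegral_congr fun ω => ?_)
    ((hY.lintegral_strongMarkov hr hτ hK).trans (lintegral_congr fun p => ?_))
  · congr 1
    refine lintegral_congr fun p => congrArg Ψ ?_
    exact (supFunctional_comp_denseTime
      (f := fun t => x + Y ((τ ω).untopD 0) ω + Y t p.1)
      (fun t => continuousWithinAt_const.add (hY.rightCont p.1 t)) p.2).symm
  · refine congrArg Ψ ?_
    have h := supFunctional_comp_denseTime (f := fun t => x + Y ((τ p.1).untopD 0 + t) p.1)
      (fun t => continuousWithinAt_const.add (hY.rightCont_add p.1 _ t))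
      (p.2 - ((τ p.1).untopD 0 : ℝ≥0))
    refine Eq.trans ?_ h
    congr 1
    funext i
    simp only [shiftedPath]
    ring

/-- The same for the increment of the supremum over the value at the stopping time. -/
lemma lintegral_exp_mul_increment [IsProbabilityMeasure P] (hY : IsRegularLevyProcess P 𝓕 Y)
    {r : ℝ} (hr : 0 ≤ r) {τ : Ω → WithTop ℝ≥0} (hτ : IsStoppingTime 𝓕 τ)
    {Ψ : EReal → ℝ≥0∞} (hΨ : Measurable Ψ) :
    ∫⁻ ω in {ω | τ ω ≠ ⊤}, ENNReal.ofReal (Real.exp (-r * (τ ω).untopD 0)) *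
        (∫⁻ p, Ψ (pathSup (fun t => Y t p.1) p.2) ∂extendedLaw P r) ∂P =
      ∫⁻ p in reached τ, Ψ (pathSup
        (fun t => Y ((τ p.1).untopD 0 + t) p.1 - Y ((τ p.1).untopD 0) p.1)
        (p.2 - ((τ p.1).untopD 0 : ℝ≥0))) ∂extendedLaw P r := by
  have hK : Measurable fun q : ℝ × ((ℕ → ℝ) × ℝ≥0∞) => Ψ (supFunctional q.2.1 q.2.2) :=
    hΨ.comp (measurable_supFunctional measurable_snd.fst measurable_snd.snd)
  refine Eq.trans (lintegral_congr fun ω => ?_)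
    ((hY.lintegral_strongMarkov hr hτ hK).trans (lintegral_congr fun p => ?_))
  · congr 1
    refine lintegral_congr fun p => congrArg Ψ ?_
    exact (supFunctional_comp_denseTime (hY.rightCont p.1) p.2).symm
  · refine congrArg Ψ ?_
    exact supFunctional_comp_denseTime
      (f := fun t => Y ((τ p.1).untopD 0 + t) p.1 - Y ((τ p.1).untopD 0) p.1)
      (fun t => (hY.rightCont_add p.1 _ t).sub continuousWithinAt_const)
      (p.2 - ((τ p.1).untopD 0 : ℝ≥0))

end IsRegularLevyProcess

/-! ### First entrance times of right-continuous paths -/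

lemma le_apply_untopD_hittingAfter {X : ℝ≥0 → Ω → ℝ} {ω : Ω} {s : Set ℝ} {c : ℝ}
    (hX : ∀ t, ContinuousWithinAt (fun t => X t ω) (Ici t) t) (hs : s ⊆ Ici c)
    (h : hittingAfter X s 0 ω ≠ ⊤) : c ≤ X ((hittingAfter X s 0 ω).untopD 0) ω := by
  have hex : ∃ j, 0 ≤ j ∧ X j ω ∈ s := by
    by_contra hne
    push Not at hne
    exact h (hittingAfter_eq_top_iff.2 hne)
  rw [hittingAfter, if_pos hex, WithTop.untopD_coe]
  have hcl := csInf_mem_closure hex (OrderBot.bddBelow _)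
  have hcont := (hX (sInf {i | 0 ≤ i ∧ X i ω ∈ s})).mono
    (fun i hi => csInf_le (OrderBot.bddBelow _) hi : {i | 0 ≤ i ∧ X i ω ∈ s} ⊆ Ici _)
  have := hcont.mem_closure hcl (t := Ici c) fun i hi => hs hi.2
  rwa [isClosed_Ici.closure_eq] at this

lemma untopD_hittingAfter_le {X : ℝ≥0 → Ω → ℝ} {ω : Ω} {s : Set ℝ} {t : ℝ≥0}
    (h : X t ω ∈ s) : hittingAfter X s 0 ω ≠ ⊤ ∧ (hittingAfter X s 0 ω).untopD 0 ≤ t := by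
  have hle : hittingAfter X s 0 ω ≤ t := hittingAfter_le_of_mem zero_le h
  refine ⟨ne_top_of_le_ne_top WithTop.coe_ne_top hle, ?_⟩
  exact WithTop.untopD_le hle

namespace IsRegularLevyProcess

lemma rightCont_startedAt (hY : IsRegularLevyProcess P 𝓕 Y) (x : ℝ) (ω : Ω) (t : ℝ≥0) :
    ContinuousWithinAt (fun t => startedAt Y x t ω) (Ici t) t :=
  continuousWithinAt_const.add (hY.rightCont ω t)

lemma isStoppingTime_hittingAfter_Ioi (hY : IsRegularLevyProcess P 𝓕 Y)
    (h𝓕 : 𝓕.IsRightContinuous) (x c : ℝ) :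
    IsStoppingTime 𝓕 (hittingAfter (startedAt Y x) (Ioi c) 0) := by
  refine isStoppingTime_of_measurableSet_lt_of_isRightContinuous fun i => ?_
  have : {ω | hittingAfter (startedAt Y x) (Ioi c) 0 ω < i} =
      ⋃ k ∈ {k | denseTime k < i}, {ω | c < startedAt Y x (denseTime k) ω} := by
    ext ω
    simp only [mem_ofPred_eq, hittingAfter_lt_iff, mem_iUnion, exists_prop]
    constructor
    · rintro ⟨j, hj, hjc⟩
      have h1 : ∀ᶠ s in 𝓝[>] j, c < startedAt Y x s ω :=
        ((hY.rightCont_startedAt x ω j).mono Ioi_subset_Ici_self).eventually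
          (eventually_gt_nhds hjc)
      have h2 : ∀ᶠ s in 𝓝[>] j, s < i := nhdsWithin_le_nhds (eventually_lt_nhds hj.2)
      obtain ⟨u, hu, hsub⟩ := (mem_nhdsGT_iff_exists_Ioo_subset).1 (h1.and h2)
      obtain ⟨k, hk⟩ := exists_denseTime_mem_Ioo hu
      exact ⟨k, (hsub hk).2, (hsub hk).1⟩
    · rintro ⟨k, hk, hkc⟩
      exact ⟨denseTime k, ⟨zero_le, hk⟩, hkc⟩
  rw [this]
  refine MeasurableSet.biUnion (to_countable _) fun k hk => ?_
  have hm : Measurable[𝓕 i] (startedAt Y x (denseTime k)) :=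
    ((hY.adapted _).mono (𝓕.mono (le_of_lt hk)) le_rfl).const_add x
  exact hm measurableSet_Ioi

lemma measurable_pathSup_shift (hY : IsRegularLevyProcess P 𝓕 Y) {σ : Ω → ℝ≥0}
    (hσ : Measurable σ) {c : Ω → ℝ} (hc : Measurable c) :
    Measurable fun p : Ω × ℝ≥0∞ =>
      pathSup (fun t => c p.1 + (Y (σ p.1 + t) p.1 - Y (σ p.1) p.1)) (p.2 - σ p.1) := by
  have h : Measurable fun p : Ω × ℝ≥0∞ =>
      supFunctional (fun i => c p.1 + shiftedPath Y (σ p.1) p.1 i) (p.2 - σ p.1) := by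
    refine measurable_supFunctional ?_
      (measurable_snd.sub (hσ.comp measurable_fst).coe_nnreal_ennreal)
    exact measurable_pi_lambda _ fun i => (hc.comp measurable_fst).add
      ((measurable_pi_apply i).comp ((hY.measurable_shiftedPath hσ).comp measurable_fst))
  have heq : (fun p : Ω × ℝ≥0∞ =>
      pathSup (fun t => c p.1 + (Y (σ p.1 + t) p.1 - Y (σ p.1) p.1)) (p.2 - σ p.1)) =
      fun p => supFunctional (fun i => c p.1 + shiftedPath Y (σ p.1) p.1 i) (p.2 - σ p.1) :=
    funext fun p => (supFunctional_comp_denseTime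
      (f := fun t => c p.1 + (Y (σ p.1 + t) p.1 - Y (σ p.1) p.1))
      (fun t => continuousWithinAt_const.add
        ((hY.rightCont_add p.1 _ t).sub continuousWithinAt_const)) _).symm
  rw [heq]
  exact h

/-! ### The supremum is not approached without being reached at a given level -/

lemma isProbabilityMeasure_extendedLaw [IsProbabilityMeasure P] {r : ℝ} (hr : 0 ≤ r) :
    IsProbabilityMeasure (extendedLaw P r) := by
  have := isProbabilityMeasure_horizonLaw hr
  unfold extendedLaw
  infer_instance

lemma tendsto_measure_pathSup_mem_Ioc [IsProbabilityMeasure P] (hY : IsRegularLevyProcess P 𝓕 Y)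
    {r : ℝ} (hr : 0 ≤ r) :
    Tendsto (fun n : ℕ => extendedLaw P r {p | pathSup (fun t => Y t p.1) p.2 ∈
      Ioc (0 : EReal) (((1 / ((n : ℝ) + 1) : ℝ)) : EReal)}) atTop (𝓝 0) := by
  have := isProbabilityMeasure_extendedLaw (P := P) hr
  have hm : Measurable fun p : Ω × ℝ≥0∞ => pathSup (fun t => Y t p.1) p.2 := by
    simpa [startedAt] using hY.measurable_pathSup 0
  have h := tendsto_measure_iInter_atTop (μ := extendedLaw P r)
    (s := fun n : ℕ => {p : Ω × ℝ≥0∞ | pathSup (fun t => Y t p.1) p.2 ∈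
      Ioc (0 : EReal) (((1 / ((n : ℝ) + 1) : ℝ)) : EReal)})
    (fun n => (hm measurableSet_Ioc).nullMeasurableSet) ?_ ⟨0, measure_ne_top _ _⟩
  · convert! h using 2
    symm
    convert! measure_empty (μ := extendedLaw P r)
    ext p
    simp only [mem_iInter, mem_ofPred_eq, mem_empty_iff_false, iff_false, not_forall]
    by_contra! hp
    have h0 := (hp 0).1
    obtain ⟨q, hq0, hq⟩ := EReal.lt_iff_exists_real_btwn.1 h0
    obtain ⟨n, hn⟩ := exists_nat_one_div_lt (EReal.coe_pos.1 hq0)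
    have h1 := hq.trans_le (hp n).2
    exact absurd hn (not_lt.2 (EReal.coe_le_coe_iff.1 h1.le))
  · intro m n hmn p hp
    refine ⟨hp.1, hp.2.trans ?_⟩
    exact EReal.coe_le_coe_iff.2 (Nat.one_div_le_one_div hmn)

/-- Almost surely the supremum over `[0, e(r)]` does not equal the level `a` unless `a` is
reached. Indeed, right after the first passage above `a - 1 / (n + 1)` the supremum of the
increments would lie in `(0, 1 / (n + 1)]`, and the probability of that tends to `0`. -/
lemma ae_pathSup_ne_of_lt [IsProbabilityMeasure P] (hY : IsRegularLevyProcess P 𝓕 Y)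
    (h𝓕 : 𝓕.IsRightContinuous) {r : ℝ} (hr : 0 ≤ r) (x a : ℝ) :
    ∀ᵐ p ∂extendedLaw P r, (∀ t : ℝ≥0, (t : ℝ≥0∞) ≤ p.2 → startedAt Y x t p.1 < a) →
      pathSup (fun t => startedAt Y x t p.1) p.2 ≠ a := by
  set X := startedAt Y x with hX
  have hle : ∀ n : ℕ, extendedLaw P r {p | ¬ ((∀ t : ℝ≥0, (t : ℝ≥0∞) ≤ p.2 → X t p.1 < a) →
      pathSup (fun t => X t p.1) p.2 ≠ a)} ≤
      extendedLaw P r {p | pathSup (fun t => Y t p.1) p.2 ∈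
        Ioc (0 : EReal) (((1 / ((n : ℝ) + 1) : ℝ)) : EReal)} := by
    intro n
    set δ : ℝ := 1 / ((n : ℝ) + 1) with hδ
    have hδ0 : 0 < δ := by positivity
    set τ := hittingAfter X (Ioi (a - δ)) 0 with hτdef
    have hτ : IsStoppingTime 𝓕 τ := hY.isStoppingTime_hittingAfter_Ioi h𝓕 x (a - δ)
    have hσ := measurable_untopD hτ
    set S : Set (Ω × ℝ≥0∞) := {p | pathSup (fun t => Y ((τ p.1).untopD 0 + t) p.1 -
      Y ((τ p.1).untopD 0) p.1) (p.2 - ((τ p.1).untopD 0 : ℝ≥0)) ∈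
        Ioc (0 : EReal) ((δ : ℝ) : EReal)} with hS
    have hSm : MeasurableSet S := by
      have := hY.measurable_pathSup_shift hσ (c := fun _ => 0) measurable_const
      simp only [zero_add] at this
      exact this measurableSet_Ioc
    have hm : Measurable fun p : Ω × ℝ≥0∞ => pathSup (fun t => Y t p.1) p.2 := by
      simpa [startedAt] using hY.measurable_pathSup 0
    calc extendedLaw P r {p | ¬ ((∀ t : ℝ≥0, (t : ℝ≥0∞) ≤ p.2 → X t p.1 < a) →
          pathSup (fun t => X t p.1) p.2 ≠ a)}
        ≤ extendedLaw P r (S ∩ reached τ) := by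
          refine measure_mono fun p hp => ?_
          simp only [mem_ofPred_eq, Classical.not_imp, not_not] at hp
          obtain ⟨hlt, hsup⟩ := hp
          have hfind : ∀ c : ℝ, c < a → ∃ t : ℝ≥0, (t : ℝ≥0∞) ≤ p.2 ∧ c < X t p.1 := by
            intro c hc
            have : (c : EReal) < pathSup (fun t => X t p.1) p.2 := by
              rw [hsup]; exact_mod_cast hc
            simp only [pathSup, lt_iSup_iff] at this
            obtain ⟨t, ht, h⟩ := this
            exact ⟨t, ht, by exact_mod_cast h⟩
          obtain ⟨t₀, ht₀, hX₀⟩ := hfind (a - δ) (by linarith)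
          obtain ⟨hne, hle₀⟩ := untopD_hittingAfter_le (s := Ioi (a - δ)) hX₀
          have hσT : (((τ p.1).untopD 0 : ℝ≥0) : ℝ≥0∞) ≤ p.2 :=
            (ENNReal.coe_le_coe.2 hle₀).trans ht₀
          refine ⟨?_, hne, hσT⟩
          have hXσ : a - δ ≤ X ((τ p.1).untopD 0) p.1 :=
            le_apply_untopD_hittingAfter (hY.rightCont_startedAt x p.1) Ioi_subset_Ici_self hne
          have hXσ' := hlt _ hσT
          refine ⟨?_, pathSup_le fun t ht => ?_⟩
          · obtain ⟨t, ht, htX⟩ := hfind (max (a - δ) (X ((τ p.1).untopD 0) p.1))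
              (max_lt (by linarith) hXσ')
            obtain ⟨h1, h2⟩ := max_lt_iff.1 htX
            obtain ⟨-, hle⟩ := untopD_hittingAfter_le (s := Ioi (a - δ)) h1
            refine lt_of_lt_of_le ?_ (le_pathSup (f := fun t =>
              Y ((τ p.1).untopD 0 + t) p.1 - Y ((τ p.1).untopD 0) p.1)
              (t := t - (τ p.1).untopD 0) ?_)
            · rw [add_tsub_cancel_of_le hle]
              simp only [hX, startedAt] at h2
              exact_mod_cast sub_pos.2 (by linarith)
            · rw [ENNReal.coe_sub]
              exact tsub_le_tsub_right ht _
          · have h1 : (((τ p.1).untopD 0 + t : ℝ≥0) : ℝ≥0∞) ≤ p.2 := by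
              rw [ENNReal.coe_add]
              exact (add_le_add_right ht _).trans_eq (add_tsub_cancel_of_le hσT)
            have h2 := hlt _ h1
            simp only [hX, startedAt] at h2 hXσ
            exact_mod_cast (by linarith : Y ((τ p.1).untopD 0 + t) p.1 -
              Y ((τ p.1).untopD 0) p.1 ≤ δ)
      _ = ∫⁻ p in reached τ, (Ioc (0 : EReal) ((δ : ℝ) : EReal)).indicator 1
            (pathSup (fun t => Y ((τ p.1).untopD 0 + t) p.1 - Y ((τ p.1).untopD 0) p.1)
              (p.2 - ((τ p.1).untopD 0 : ℝ≥0))) ∂extendedLaw P r := by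
          rw [← Measure.restrict_apply hSm, ← lintegral_indicator_one hSm]
          rfl
      _ = ∫⁻ ω in {ω | τ ω ≠ ⊤}, ENNReal.ofReal (Real.exp (-r * (τ ω).untopD 0)) *
            (∫⁻ p, (Ioc (0 : EReal) ((δ : ℝ) : EReal)).indicator 1
              (pathSup (fun t => Y t p.1) p.2) ∂extendedLaw P r) ∂P :=
          (hY.lintegral_exp_mul_increment hr hτ
            (measurable_const.indicator measurableSet_Ioc)).symm
      _ ≤ ∫⁻ ω in {ω | τ ω ≠ ⊤}, (∫⁻ p, (Ioc (0 : EReal) ((δ : ℝ) : EReal)).indicator 1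
              (pathSup (fun t => Y t p.1) p.2) ∂extendedLaw P r) ∂P := by
          refine lintegral_mono fun ω => mul_le_of_le_one_left zero_le ?_
          rw [ENNReal.ofReal_le_one, Real.exp_le_one_iff]
          have := ((τ ω).untopD 0).coe_nonneg
          nlinarith
      _ ≤ ∫⁻ p, (Ioc (0 : EReal) ((δ : ℝ) : EReal)).indicator 1
              (pathSup (fun t => Y t p.1) p.2) ∂extendedLaw P r := by
          rw [lintegral_const, Measure.restrict_apply_univ]
          exact mul_le_of_le_one_right zero_le prob_le_one
      _ = extendedLaw P r {p | pathSup (fun t => Y t p.1) p.2 ∈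
            Ioc (0 : EReal) ((δ : ℝ) : EReal)} := by
          exact lintegral_indicator_one (hm measurableSet_Ioc)
  exact le_antisymm (ge_of_tendsto' (hY.tendsto_measure_pathSup_mem_Ioc hr) hle) zero_le

/-! ### The first entrance time is a stopping time -/

lemma horizonLaw_one_Icc_ne_zero {s t : ℝ≥0} (h : s < t) :
    horizonLaw 1 (Icc (s : ℝ≥0∞) t) ≠ 0 := by
  intro h0
  rw [horizonLaw, if_neg one_ne_zero, Measure.map_apply ENNReal.measurable_ofReal
    measurableSet_Icc] at h0
  have h1 : Ioo (s : ℝ) t ⊆ ENNReal.ofReal ⁻¹' Icc (s : ℝ≥0∞) t := by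
    intro u hu
    rw [mem_preimage, ← ENNReal.ofReal_coe_nnreal (p := s), ← ENNReal.ofReal_coe_nnreal (p := t)]
    exact ⟨ENNReal.ofReal_le_ofReal hu.1.le, ENNReal.ofReal_le_ofReal hu.2.le⟩
  have h2 := measure_mono_null h1 h0
  have h3 : expMeasure 1 = volume.withDensity (exponentialPDF 1) := rfl
  have hpdf : Measurable (exponentialPDF 1) := (measurable_exponentialPDFReal 1).ennreal_ofReal
  rw [h3, withDensity_apply_eq_zero hpdf] at h2
  have h4 : Ioo (s : ℝ) t ⊆ {u | exponentialPDF 1 u ≠ 0} ∩ Ioo (s : ℝ) t := by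
    refine fun u hu => ⟨?_, hu⟩
    have hu0 : 0 ≤ u := s.coe_nonneg.trans hu.1.le
    have := exponentialPDF_of_nonneg (r := 1) hu0
    rw [mem_ofPred_eq, this]
    simp [Real.exp_pos]
  have h5 := measure_mono_null h4 h2
  rw [Real.volume_Ioo, ENNReal.ofReal_eq_zero] at h5
  have : (s : ℝ) < t := by exact_mod_cast h
  linarith

/-- The first entrance time is a.s. the limit of the first passage times above the levels
`xs - 1 / (n + 1)`, which are stopping times because the filtration is right-continuous. -/
lemma isStoppingTime_entranceTime [IsProbabilityMeasure P] (hY : IsRegularLevyProcess P 𝓕 Y)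
    (h𝓕 : UsualConditions P 𝓕) (x a : ℝ) :
    IsStoppingTime 𝓕 (entranceTime (startedAt Y x) a) := by
  intro i
  set X := startedAt Y x with hX
  set τ : ℕ → Ω → WithTop ℝ≥0 := fun n => hittingAfter X (Ioi (a - 1 / ((n : ℝ) + 1))) 0 with hτ
  have hanti : ∀ n ω, τ n ω ≤ entranceTime X a ω := fun n ω => by
    refine hittingAfter_apply_anti X 0 ω (fun y hy => ?_)
    have : (0 : ℝ) < 1 / ((n : ℝ) + 1) := by positivity
    have : a ≤ y := hy
    exact mem_Ioi.2 (by linarith)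
  set D : Set Ω := {ω | (∀ n, τ n ω ≤ i) ∧ i < entranceTime X a ω} with hD
  have hDk : ∀ k, i < denseTime k → P (D ∩ {ω | (denseTime k : WithTop ℝ≥0) <
      entranceTime X a ω}) = 0 := by
    intro k hk
    have hB := hY.ae_pathSup_ne_of_lt h𝓕.rightContinuous zero_le_one x a
    rw [ae_iff] at hB
    have hsub : (D ∩ {ω | (denseTime k : WithTop ℝ≥0) < entranceTime X a ω}) ×ˢ
        Icc (i : ℝ≥0∞) (denseTime k) ⊆
        {p : Ω × ℝ≥0∞ | ¬ ((∀ t : ℝ≥0, (t : ℝ≥0∞) ≤ p.2 → X t p.1 < a) →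
          pathSup (fun t => X t p.1) p.2 ≠ a)} := by
      rintro ⟨ω, T⟩ ⟨⟨hω, hωk⟩, hT⟩
      simp only [mem_ofPred_eq, Classical.not_imp, not_not]
      have hlt : ∀ t : ℝ≥0, (t : ℝ≥0∞) ≤ T → X t ω < a := by
        intro t ht
        have htk : t ≤ denseTime k := ENNReal.coe_le_coe.1 (ht.trans hT.2)
        have := notMem_of_lt_hittingAfter
          ((WithTop.coe_le_coe.2 htk).trans_lt hωk) zero_le
        exact not_le.1 this
      refine ⟨hlt, le_antisymm (pathSup_le fun t ht => ?_) ?_⟩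
      · exact_mod_cast (hlt t ht).le
      · by_contra! hlt'
        obtain ⟨c, hc', hc⟩ := EReal.lt_iff_exists_real_btwn.1 hlt'
        obtain ⟨n, hn⟩ := exists_nat_one_div_lt (sub_pos.2 (EReal.coe_lt_coe_iff.1 hc))
        have hne : τ n ω ≠ ⊤ := ne_top_of_le_ne_top WithTop.coe_ne_top (hω.1 n)
        have h1 : a - 1 / ((n : ℝ) + 1) ≤ X ((τ n ω).untopD 0) ω :=
          le_apply_untopD_hittingAfter (hY.rightCont_startedAt x ω) Ioi_subset_Ici_self hne
        have h2 : (((τ n ω).untopD 0 : ℝ≥0) : ℝ≥0∞) ≤ T :=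
          (ENNReal.coe_le_coe.2 (WithTop.untopD_le (hω.1 n))).trans hT.1
        refine absurd ((le_pathSup (f := fun t => X t ω) h2).trans_lt hc') (not_lt.2 ?_)
        exact_mod_cast (by linarith : c ≤ X ((τ n ω).untopD 0) ω)
    have h0 := measure_mono_null hsub hB
    rw [extendedLaw] at h0
    have := isProbabilityMeasure_horizonLaw zero_le_one
    rw [Measure.prod_prod, mul_eq_zero] at h0
    exact h0.resolve_right (horizonLaw_one_Icc_ne_zero hk)
  have hD0 : P D = 0 := by
    have hsub : D ⊆ ⋃ k ∈ {k | i < denseTime k},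
        D ∩ {ω | (denseTime k : WithTop ℝ≥0) < entranceTime X a ω} := by
      intro ω hω
      obtain ⟨u, hu, hu'⟩ : ∃ u : ℝ≥0, i < u ∧ (u : WithTop ℝ≥0) ≤ entranceTime X a ω := by
        cases h : entranceTime X a ω with
        | top => exact ⟨i + 1, by simp, le_top⟩
        | coe b =>
          refine ⟨b, ?_, le_rfl⟩
          have := hω.2
          rw [h] at this
          exact WithTop.coe_lt_coe.1 this
      obtain ⟨k, hk⟩ := exists_denseTime_mem_Ioo hu
      simp only [mem_iUnion]
      exact ⟨k, hk.1, hω, (WithTop.coe_lt_coe.2 hk.2).trans_le hu'⟩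
    refine measure_mono_null hsub ?_
    exact (measure_biUnion_null_iff (to_countable _)).2 hDk
  have hEq : {ω | entranceTime X a ω ≤ i} = (⋂ n, {ω | τ n ω ≤ i}) \ D := by
    ext ω
    simp only [mem_ofPred_eq, Set.mem_sdiff, mem_iInter, hD, not_and, not_lt]
    exact ⟨fun h => ⟨fun n => (hanti n ω).trans h, fun _ => h⟩, fun h => h.2 h.1⟩
  rw [hEq]
  refine (MeasurableSet.iInter fun n => ?_).diff (𝓕.mono zero_le _ (h𝓕.complete D hD0))
  exact hY.isStoppingTime_hittingAfter_Ioi h𝓕.rightContinuous x _ i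

end IsRegularLevyProcess

/-! ### The value function and its supermartingale property -/

/-- `E_x Ψ(M)` for a function `Ψ` of the extended-real supremum `M`, as an element of `[0, ∞]`. -/
noncomputable def supMean (P : Measure Ω) (r : ℝ) (Y : ℝ≥0 → Ω → ℝ) (Ψ : EReal → ℝ≥0∞) (x : ℝ) :
    ℝ≥0∞ :=
  ∫⁻ p, Ψ (pathSup (fun t => startedAt Y x t p.1) p.2) ∂extendedLaw P r

lemma monotone_supMean (P : Measure Ω) (r : ℝ) (Y : ℝ≥0 → Ω → ℝ) {Ψ : EReal → ℝ≥0∞}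
    (hΨ : Monotone Ψ) : Monotone (supMean P r Y Ψ) := fun x y hxy =>
  lintegral_mono fun p => hΨ (pathSup_mono fun t => by simpa [startedAt] using hxy)

namespace IsRegularLevyProcess

/-- Stopping at `τ` and then receiving `V(X_τ)` is at most as good as receiving `Ψ(M)`, which
counts only on `{τ ≤ e(r)}`. -/
lemma lintegral_exp_mul_supMean_le [IsProbabilityMeasure P] (hY : IsRegularLevyProcess P 𝓕 Y)
    {r : ℝ} (hr : 0 ≤ r) {τ : Ω → WithTop ℝ≥0} (hτ : IsStoppingTime 𝓕 τ)
    {Ψ : EReal → ℝ≥0∞} (hΨ : Monotone Ψ) (x : ℝ) :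
    ∫⁻ ω in {ω | τ ω ≠ ⊤}, ENNReal.ofReal (Real.exp (-r * (τ ω).untopD 0)) *
        supMean P r Y Ψ (startedAt Y x ((τ ω).untopD 0) ω) ∂P ≤
      ∫⁻ p in reached τ, Ψ (pathSup (fun t => startedAt Y x t p.1) p.2) ∂extendedLaw P r := by
  refine (hY.lintegral_exp_mul_valueAt hr hτ hΨ.measurable x).trans_le ?_
  refine setLIntegral_mono' (measurableSet_reached hτ) fun p hp => hΨ (pathSup_le fun t ht => ?_)
  refine le_pathSup (f := fun t => startedAt Y x t p.1) ?_
  rw [ENNReal.coe_add]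
  exact (add_le_add_right ht _).trans_eq (add_tsub_cancel_of_le hp.2)

/-! ### The discounted value vanishes at infinity when the rate is positive -/

/-- Maximal inequality along a finite set of times. -/
lemma mul_measure_exists_finset_le [IsProbabilityMeasure P] (hY : IsRegularLevyProcess P 𝓕 Y)
    {r : ℝ} (hr : 0 ≤ r) {Ψ : EReal → ℝ≥0∞} (hΨ : Monotone Ψ) (x : ℝ) (c : ℝ≥0∞) {s : ℝ≥0}
    {F : Finset ℝ≥0} (hF : ∀ q ∈ F, s ≤ q) :
    c * P {ω | ∃ q ∈ F, c < ENNReal.ofReal (Real.exp (-r * q)) *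
        supMean P r Y Ψ (startedAt Y x q ω)} ≤
      ∫⁻ p in {p | (s : ℝ≥0∞) ≤ p.2}, Ψ (pathSup (fun t => startedAt Y x t p.1) p.2)
        ∂extendedLaw P r := by
  classical
  set Z : ℝ≥0 → Ω → ℝ≥0∞ := fun q ω => ENNReal.ofReal (Real.exp (-r * q)) *
        supMean P r Y Ψ (startedAt Y x q ω) with hZ
  have hZm : ∀ q, MeasurableSet[𝓕 q] {ω | c < Z q ω} := fun q => by
    have h1 : Measurable[𝓕 q] (startedAt Y x q) := (hY.adapted q).const_add x
    have h2 : Measurable[𝓕 q] (Z q) :=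
      ((monotone_supMean P r Y hΨ).measurable.comp h1).const_mul _
    exact h2 measurableSet_Ioi
  -- the first time in `F` at which the discounted value exceeds `c`
  set τ : Ω → WithTop ℝ≥0 := fun ω =>
    F.inf fun q => if c < Z q ω then (q : WithTop ℝ≥0) else ⊤ with hτdef
  have hτ : IsStoppingTime 𝓕 τ := by
    intro i
    have : {ω | τ ω ≤ i} = ⋃ q ∈ F.filter (· ≤ i), {ω | c < Z q ω} := by
      ext ω
      simp only [hτdef, mem_ofPred_eq, mem_iUnion, Finset.mem_filter, exists_prop]
      rw [Finset.inf_le_iff (WithTop.coe_lt_top i)]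
      constructor
      · rintro ⟨q, hq, hle⟩
        split_ifs at hle with h
        · exact ⟨q, ⟨hq, WithTop.coe_le_coe.1 hle⟩, h⟩
        · exact absurd (top_le_iff.1 hle) WithTop.coe_ne_top
      · rintro ⟨q, ⟨hq, hqi⟩, h⟩
        exact ⟨q, hq, by rw [if_pos h]; exact WithTop.coe_le_coe.2 hqi⟩
    rw [this]
    exact Finset.measurableSet_biUnion _ fun q hq =>
      𝓕.mono (Finset.mem_filter.1 hq).2 _ (hZm q)
  have hspec : ∀ ω, τ ω ≠ ⊤ → (τ ω).untopD 0 ∈ F ∧ c < Z ((τ ω).untopD 0) ω := by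
    intro ω hω
    have hne : F.Nonempty := by
      by_contra h
      rw [Finset.not_nonempty_iff_eq_empty] at h
      exact hω (by simp [hτdef, h])
    obtain ⟨q, hq, hqe⟩ := Finset.exists_mem_eq_inf F hne
      fun q => if c < Z q ω then (q : WithTop ℝ≥0) else ⊤
    have hτq : τ ω = if c < Z q ω then (q : WithTop ℝ≥0) else ⊤ := hqe
    split_ifs at hτq with h
    · rw [hτq, WithTop.untopD_coe]
      exact ⟨hq, h⟩
    · exact absurd hτq hω
  have hev : {ω | ∃ q ∈ F, c < Z q ω} ⊆ {ω | τ ω ≠ ⊤} := by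
    rintro ω ⟨q, hq, h⟩
    have : τ ω ≤ q := (Finset.inf_le hq).trans_eq (if_pos h)
    exact ne_top_of_le_ne_top WithTop.coe_ne_top this
  calc c * P {ω | ∃ q ∈ F, c < Z q ω} ≤ c * P {ω | τ ω ≠ ⊤} := by gcongr
    _ = ∫⁻ ω in {ω | τ ω ≠ ⊤}, c ∂P := by rw [lintegral_const, Measure.restrict_apply_univ]
    _ ≤ ∫⁻ ω in {ω | τ ω ≠ ⊤}, ENNReal.ofReal (Real.exp (-r * (τ ω).untopD 0)) *
        supMean P r Y Ψ (startedAt Y x ((τ ω).untopD 0) ω) ∂P :=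
      setLIntegral_mono' hτ.measurableSet_eq_top.compl fun ω hω => (hspec ω hω).2.le
    _ ≤ _ := hY.lintegral_exp_mul_supMean_le hr hτ hΨ x
    _ ≤ _ := lintegral_mono_set fun p hp =>
      (ENNReal.coe_le_coe.2 (hF _ (hspec p.1 hp.1).1)).trans hp.2

lemma mul_measure_exists_denseTime_le [IsProbabilityMeasure P]
    (hY : IsRegularLevyProcess P 𝓕 Y) {r : ℝ} (hr : 0 ≤ r) {Ψ : EReal → ℝ≥0∞} (hΨ : Monotone Ψ)
    (x : ℝ) (c : ℝ≥0∞) (s : ℝ≥0) :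
    c * P {ω | ∃ k, s ≤ denseTime k ∧ c < ENNReal.ofReal (Real.exp (-r * denseTime k)) *
        supMean P r Y Ψ (startedAt Y x (denseTime k) ω)} ≤
      ∫⁻ p in {p | (s : ℝ≥0∞) ≤ p.2}, Ψ (pathSup (fun t => startedAt Y x t p.1) p.2)
        ∂extendedLaw P r := by
  classical
  set F : ℕ → Finset ℝ≥0 := fun N => ((Finset.range N).image denseTime).filter (s ≤ ·) with hF
  set E : ℕ → Set Ω := fun N => {ω | ∃ q ∈ F N, c < ENNReal.ofReal (Real.exp (-r * q)) *
        supMean P r Y Ψ (startedAt Y x q ω)} with hE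
  have hU : {ω | ∃ k, s ≤ denseTime k ∧ c < ENNReal.ofReal (Real.exp (-r * denseTime k)) *
        supMean P r Y Ψ (startedAt Y x (denseTime k) ω)} = ⋃ N, E N := by
    ext ω
    simp only [hE, hF, mem_ofPred_eq, mem_iUnion, Finset.mem_filter, Finset.mem_image,
      Finset.mem_range]
    constructor
    · rintro ⟨k, hk, h⟩
      exact ⟨k + 1, denseTime k, ⟨⟨k, Nat.lt_succ_self k, rfl⟩, hk⟩, h⟩
    · rintro ⟨N, q, ⟨⟨k, -, rfl⟩, hk⟩, h⟩
      exact ⟨k, hk, h⟩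
  have hmono : Monotone E := by
    rintro N N' hN ω ⟨q, hq, h⟩
    refine ⟨q, ?_, h⟩
    simp only [hF, Finset.mem_filter, Finset.mem_image, Finset.mem_range] at hq ⊢
    obtain ⟨⟨k, hk, rfl⟩, hs⟩ := hq
    exact ⟨⟨k, hk.trans_le hN, rfl⟩, hs⟩
  rw [hU, hmono.measure_iUnion, ENNReal.mul_iSup]
  exact iSup_le fun N => hY.mul_measure_exists_finset_le hr hΨ x c
    fun q hq => (Finset.mem_filter.1 hq).2

/-- When `r > 0`, the discounted value of the current state tends to `0` almost surely. The slack
`1` in the starting point lets dense times control all times, by right-continuity of the paths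
(the value function itself need not be continuous). -/
lemma ae_tendsto_exp_mul_supMean [IsProbabilityMeasure P] (hY : IsRegularLevyProcess P 𝓕 Y)
    {r : ℝ} (hr : 0 < r) {Ψ : EReal → ℝ≥0∞} (hΨ : Monotone Ψ) (x : ℝ)
    (hfin : supMean P r Y Ψ (x + 1) ≠ ⊤) :
    ∀ᵐ ω ∂P, Tendsto (fun t : ℝ≥0 => ENNReal.ofReal (Real.exp (-r * t)) *
      supMean P r Y Ψ (startedAt Y x t ω)) atTop (𝓝 0) := by
  have := isProbabilityMeasure_extendedLaw (P := P) hr.le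
  have := isProbabilityMeasure_horizonLaw hr.le
  -- the tails of the integral vanish because the horizon is finite
  have htail : Tendsto (fun n : ℕ => ∫⁻ p in {p : Ω × ℝ≥0∞ | (((n : ℝ≥0)) : ℝ≥0∞) ≤ p.2},
      Ψ (pathSup (fun t => startedAt Y (x + 1) t p.1) p.2) ∂extendedLaw P r) atTop (𝓝 0) := by
    refine tendsto_setLIntegral_zero hfin ?_
    have h := tendsto_measure_iInter_atTop (μ := extendedLaw P r)
      (s := fun n : ℕ => {p : Ω × ℝ≥0∞ | (((n : ℝ≥0)) : ℝ≥0∞) ≤ p.2})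
      (fun n => (measurableSet_le measurable_const measurable_snd).nullMeasurableSet)
      (fun m n hmn p hp => le_trans (ENNReal.coe_le_coe.2 (Nat.cast_le.2 hmn)) hp)
      ⟨0, measure_ne_top _ _⟩
    convert! h using 2
    symm
    have hsub : (⋂ n : ℕ, {p : Ω × ℝ≥0∞ | (((n : ℝ≥0)) : ℝ≥0∞) ≤ p.2}) ⊆ univ ×ˢ {⊤} := by
      intro p hp
      simp only [mem_iInter, mem_ofPred_eq] at hp
      refine ⟨mem_univ _, ?_⟩
      rw [mem_singleton_iff]
      refine ENNReal.eq_top_of_forall_nnreal_le fun q => ?_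
      obtain ⟨n, hn⟩ := exists_nat_ge q
      exact le_trans (by exact_mod_cast hn) (hp n)
    refine measure_mono_null hsub ?_
    rw [extendedLaw, Measure.prod_prod]
    have h0 := ae_lt_top_horizonLaw hr
    rw [ae_iff] at h0
    simp only [not_lt, top_le_iff] at h0
    rw [show ({⊤} : Set ℝ≥0∞) = {a | a = ⊤} from rfl, h0, mul_zero]
  have hae : ∀ m : ℕ, ∀ᵐ ω ∂P, ∃ n : ℕ, ∀ k, (n : ℝ≥0) ≤ denseTime k →
      ENNReal.ofReal (Real.exp (-r * denseTime k)) *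
        supMean P r Y Ψ (startedAt Y (x + 1) (denseTime k) ω) ≤ ((m : ℝ≥0∞) + 1)⁻¹ := by
    intro m
    set c : ℝ≥0∞ := ((m : ℝ≥0∞) + 1)⁻¹ with hc
    have hc0 : c ≠ 0 := by simp [hc]
    rw [ae_iff]
    have hz : c * P {ω | ¬ ∃ n : ℕ, ∀ k, (n : ℝ≥0) ≤ denseTime k →
      ENNReal.ofReal (Real.exp (-r * denseTime k)) *
        supMean P r Y Ψ (startedAt Y (x + 1) (denseTime k) ω) ≤ c} ≤ 0 := by
      refine ge_of_tendsto' htail fun n => le_trans ?_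
        (hY.mul_measure_exists_denseTime_le hr.le hΨ (x + 1) c n)
      refine mul_le_mul_right (measure_mono fun ω hω => ?_) _
      simp only [mem_ofPred_eq] at hω ⊢
      push Not at hω
      exact hω n
    exact (mul_eq_zero.1 (le_antisymm hz zero_le)).resolve_left hc0
  filter_upwards [ae_all_iff.2 hae] with ω hω
  rw [ENNReal.tendsto_nhds_zero]
  intro ε hε
  obtain ⟨m, hm⟩ := ENNReal.exists_inv_nat_lt hε.ne'
  obtain ⟨n, hn⟩ := hω m
  filter_upwards [eventually_ge_atTop (n : ℝ≥0)] with t ht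
  refine le_trans ?_ hm.le
  refine le_trans ?_ (ENNReal.inv_le_inv.2 le_self_add : ((m : ℝ≥0∞) + 1)⁻¹ ≤ _)
  by_contra! hlt
  have h1 : ∀ᶠ s : ℝ≥0 in 𝓝[>] t, ((m : ℝ≥0∞) + 1)⁻¹ < ENNReal.ofReal (Real.exp (-r * s)) *
      supMean P r Y Ψ (startedAt Y x t ω) := by
    have hcont : Tendsto (fun s : ℝ≥0 => ENNReal.ofReal (Real.exp (-r * s)) *
        supMean P r Y Ψ (startedAt Y x t ω)) (𝓝 t) (𝓝 (ENNReal.ofReal (Real.exp (-r * t)) *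
        supMean P r Y Ψ (startedAt Y x t ω))) := by
      refine ENNReal.Tendsto.mul_const ?_ (Or.inl ?_)
      · have : Continuous fun s : ℝ≥0 => ENNReal.ofReal (Real.exp (-r * s)) :=
          ENNReal.continuous_ofReal.comp (by fun_prop)
        exact this.tendsto t
      · simp [Real.exp_pos]
    exact nhdsWithin_le_nhds (hcont.eventually (eventually_gt_nhds hlt))
  have h2 : ∀ᶠ s in 𝓝[>] t, startedAt Y x t ω - 1 < startedAt Y x s ω :=
    ((hY.rightCont_startedAt x ω t).mono Ioi_subset_Ici_self).eventually
      (eventually_gt_nhds (by linarith))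
  obtain ⟨u, hu, hsub⟩ := (mem_nhdsGT_iff_exists_Ioo_subset).1 (h1.and h2)
  obtain ⟨k, hk⟩ := exists_denseTime_mem_Ioo hu
  obtain ⟨h3, h4⟩ := hsub hk
  refine absurd (hn k (ht.trans hk.1.le)) (not_le.2 (h3.trans_le ?_))
  gcongr
  refine monotone_supMean P r Y hΨ ?_
  simp only [startedAt] at h4 ⊢
  linarith

end IsRegularLevyProcess

/-! ### Lévy processes that are bounded above -/

/-- A measurable functional of the values of a path along `denseTime`. It computes the upper limit
at infinity of right-continuous paths, see `limsupFunctional_comp_denseTime`. -/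
noncomputable def limsupFunctional (y : ℕ → ℝ) : EReal :=
  ⨅ n : ℕ, ⨆ i : ℕ, if (n : ℝ≥0) < denseTime i then (y i : EReal) else ⊥

lemma measurable_limsupFunctional : Measurable limsupFunctional := by
  refine Measurable.iInf fun n => Measurable.iSup fun i => Measurable.ite ?_ ?_ measurable_const
  · exact MeasurableSet.const _
  · exact measurable_coe_real_ereal.comp (measurable_pi_apply i)

lemma limsupFunctional_comp_denseTime {f : ℝ≥0 → ℝ}
    (hf : ∀ t, ContinuousWithinAt f (Ici t) t) :
    limsupFunctional (fun i => f (denseTime i)) = limsup (fun t => (f t : EReal)) atTop := by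
  apply le_antisymm
  · rw [limsup_eq_iInf_iSup]
    refine le_iInf₂ fun S hS => ?_
    obtain ⟨a, ha⟩ := mem_atTop_sets.1 hS
    obtain ⟨n, hn⟩ := exists_nat_ge a
    refine (iInf_le _ n).trans (iSup_le fun i => ?_)
    split_ifs with h
    · exact le_iSup₂ (f := fun t (_ : t ∈ S) => (f t : EReal)) _ (ha _ (hn.trans h.le))
    · exact bot_le
  · refine le_iInf fun n => limsup_le_of_le (by isBoundedDefault) ?_
    filter_upwards [eventually_ge_atTop (n : ℝ≥0)] with t ht
    refine le_of_forall_lt fun c hc => ?_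
    have h1 : ∀ᶠ s in 𝓝[>] t, c < (f s : EReal) := by
      have : ContinuousWithinAt (fun s => (f s : EReal)) (Ici t) t :=
        continuous_coe_real_ereal.continuousAt.comp_continuousWithinAt (hf t)
      exact (this.mono Ioi_subset_Ici_self).eventually (eventually_gt_nhds hc)
    obtain ⟨u, hu, hsub⟩ := (mem_nhdsGT_iff_exists_Ioo_subset).1 h1
    obtain ⟨i, hi⟩ := exists_denseTime_mem_Ioo hu
    refine lt_of_lt_of_le (hsub hi) (le_iSup_of_le i ?_)
    rw [if_pos (ht.trans_lt hi.1)]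

lemma limsup_comp_const_add (f : ℝ≥0 → EReal) (s : ℝ≥0) :
    limsup (fun t => f (s + t)) atTop = limsup f atTop := by
  have h : map (fun t : ℝ≥0 => s + t) atTop = atTop := by
    refine map_atTop_eq_of_gc (fun t => t - s) s (fun a b hab => by gcongr) ?_ ?_
    · intro a b hb
      rw [add_comm, le_tsub_iff_right hb]
    · intro b hb
      rw [add_tsub_cancel_of_le hb]
  conv_rhs => rw [← h]
  rfl

namespace IsRegularLevyProcess

lemma limsupFunctional_path (hY : IsRegularLevyProcess P 𝓕 Y) (ω : Ω) :
    limsupFunctional (fun i => Y (denseTime i) ω) =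
      limsup (fun t => (Y t ω : EReal)) atTop :=
  limsupFunctional_comp_denseTime (hY.rightCont ω)

lemma limsupFunctional_path_eq_add (hY : IsRegularLevyProcess P 𝓕 Y) (s : ℝ≥0) (ω : Ω) :
    limsupFunctional (fun i => Y (denseTime i) ω) =
      Y s ω + limsupFunctional (shiftedPath Y s ω) := by
  have h := limsupFunctional_comp_denseTime (f := fun t => Y (s + t) ω - Y s ω)
    fun t => (hY.rightCont_add ω s t).sub continuousWithinAt_const
  have h' : limsupFunctional (shiftedPath Y s ω) =
      limsup (fun t => ((Y (s + t) ω - Y s ω : ℝ) : EReal)) atTop := h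
  rw [h', hY.limsupFunctional_path, ← limsup_comp_const_add _ s]
  have hsum : (fun t => (Y (s + t) ω : EReal)) =
      (fun t => ((Y (s + t) ω - Y s ω : ℝ) : EReal)) + fun _ => (Y s ω : EReal) := by
    funext t
    rw [Pi.add_apply, ← EReal.coe_add, sub_add_cancel]
  rw [hsum, add_comm (Y s ω : EReal)]
  refine le_antisymm ?_ ?_
  · refine (EReal.limsup_add_le (Or.inr ?_) (Or.inr ?_)).trans_eq ?_ <;>
      simp [limsup_const]
  · refine Eq.trans_le ?_ EReal.le_limsup_add
    rw [liminf_const]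

/-- If the upper limit of the process is finite with positive probability, then the process
vanishes: the characteristic function of the upper limit `L` satisfies `φ_L = φ_{Y_s} φ_L`,
as `L - Y_s` is a copy of `L` independent of `Y_s`, so `φ_{Y_s} = 1` near `0`. -/
lemma ae_eq_zero_of_limsup_ne_bot [IsProbabilityMeasure P] (hY : IsRegularLevyProcess P 𝓕 Y)
    (htop : ∀ᵐ ω ∂P, limsupFunctional (fun i => Y (denseTime i) ω) ≠ ⊤)
    (hbot : ¬ ∀ᵐ ω ∂P, limsupFunctional (fun i => Y (denseTime i) ω) = ⊥) (s : ℝ≥0) :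
    ∀ᵐ ω ∂P, Y s ω = 0 := by
  have := hY.isProbabilityMeasure_pathLaw
  let h : ℝ → (ℕ → ℝ) → ℂ := fun u y =>
    if limsupFunctional y = ⊥ then 0
    else Complex.exp ((u * (limsupFunctional y).toReal : ℝ) * Complex.I)
  have hset : MeasurableSet {y | limsupFunctional y = ⊥} :=
    measurable_limsupFunctional (measurableSet_singleton ⊥)
  have hhm : ∀ u, Measurable (h u) := fun u => by
    refine Measurable.ite hset measurable_const ?_
    have := measurable_limsupFunctional.ereal_toReal
    fun_prop
  have hhb : ∀ u y, ‖h u y‖ ≤ 1 := fun u y => by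
    simp only [h]
    split_ifs
    · simp
    · rw [Complex.norm_exp_ofReal_mul_I]
  set c : ℝ → ℂ := fun u => ∫ y, h u y ∂pathLaw P Y with hc
  have hcc : Continuous c := by
    refine continuous_of_dominated (bound := fun _ => 1)
      (fun u => (hhm u).aestronglyMeasurable) (fun u => ae_of_all _ (hhb u))
      (integrable_const _) (ae_of_all _ fun y => ?_)
    simp only [h]
    split_ifs
    · exact continuous_const
    · fun_prop
  have hc0 : c 0 ≠ 0 := by
    have : c 0 = ((pathLaw P Y).real {y | limsupFunctional y = ⊥}ᶜ : ℂ) := by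
      have h0 : h 0 = {y | limsupFunctional y = ⊥}ᶜ.indicator fun _ => (1 : ℂ) := by
        funext y
        by_cases hy : limsupFunctional y = ⊥ <;> simp [h, hy]
      rw [hc]
      simp only [h0]
      rw [integral_indicator_const _ hset.compl]
      simp
    rw [this]
    norm_cast
    rw [measureReal_eq_zero_iff, pathLaw, Measure.map_apply hY.measurable_path hset.compl]
    exact hbot
  -- the functional equation
  have hfun : ∀ u, c u = (∫ ω, Complex.exp ((u * Y s ω : ℝ) * Complex.I) ∂P) * c u := by
    intro u
    have hms : Measurable (shiftedPath Y s) := hY.measurable_shiftedPath measurable_const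
    have hYm : Measurable[𝓕 s] fun ω => Complex.exp ((u * Y s ω : ℝ) * Complex.I) := by
      have h1 : Measurable fun v : ℝ => Complex.exp ((u * v : ℝ) * Complex.I) := by fun_prop
      exact h1.comp (hY.adapted s)
    have hind := hY.indepFun_shiftedPath s hYm (hhm u)
    have h1 := hind.integral_fun_mul_eq_mul_integral
      (hYm.mono (𝓕.le s) le_rfl).aestronglyMeasurable ((hhm u).comp hms).aestronglyMeasurable
    have h2 : c u = ∫ ω, h u (shiftedPath Y s ω) ∂P := by
      simp only [hc]
      rw [← hY.map_shiftedPath s, integral_map hms.aemeasurable (hhm u).aestronglyMeasurable]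
    have h3 : c u = ∫ ω, h u (fun i => Y (denseTime i) ω) ∂P := by
      simp only [hc]
      rw [pathLaw, integral_map hY.measurable_path.aemeasurable (hhm u).aestronglyMeasurable]
    rw [h2, ← h1, ← h2, h3]
    refine integral_congr_ae ?_
    filter_upwards [htop] with ω hω
    have hL := hY.limsupFunctional_path_eq_add s ω
    simp only [h]
    by_cases hb : limsupFunctional (shiftedPath Y s ω) = ⊥
    · rw [hL, hb]
      simp
    · have hb' : limsupFunctional (shiftedPath Y s ω) ≠ ⊤ := by
        intro hb'
        rw [hb', EReal.coe_add_top] at hL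
        exact hω hL
      lift limsupFunctional (shiftedPath Y s ω) to ℝ using ⟨hb', hb⟩ with l
      rw [hL, if_neg (by exact_mod_cast EReal.coe_ne_bot _), if_neg (EReal.coe_ne_bot _),
        ← Complex.exp_add]
      congr 1
      rw [← EReal.coe_add, EReal.toReal_coe, EReal.toReal_coe]
      push_cast
      ring
  -- hence `E cos (u Y_s) = 1` for small `u`
  have hnear : ∀ᶠ u in 𝓝 (0 : ℝ), c u ≠ 0 := hcc.continuousAt.eventually_ne hc0
  obtain ⟨δ, hδ, hδc⟩ := Metric.eventually_nhds_iff.1 hnear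
  have hcos : ∀ u, |u| < δ → ∀ᵐ ω ∂P, Real.cos (u * Y s ω) = 1 := by
    intro u hu
    have h1 : ∫ ω, Complex.exp ((u * Y s ω : ℝ) * Complex.I) ∂P = 1 := by
      have hcu := hδc (y := u) (by simpa using hu)
      have := hfun u
      exact (mul_eq_right₀ hcu).1 this.symm
    have hYm := hY.measurable s
    have hint : Integrable (fun ω => Complex.exp ((u * Y s ω : ℝ) * Complex.I)) P := by
      refine Integrable.of_bound (by fun_prop) 1 (ae_of_all _ fun ω => ?_)
      rw [Complex.norm_exp_ofReal_mul_I]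
    have h2 : ∫ ω, Real.cos (u * Y s ω) ∂P = 1 := by
      have h3 := congrArg Complex.re h1
      rw [← RCLike.re_eq_complex_re, ← integral_re hint] at h3
      simpa only [RCLike.re_eq_complex_re, Complex.exp_ofReal_mul_I_re, Complex.one_re] using h3
    have hci : Integrable (fun ω => Real.cos (u * Y s ω)) P :=
      Integrable.of_bound (by fun_prop) 1 (ae_of_all _ fun ω => Real.abs_cos_le_one _)
    have h4 : ∫ ω, (1 - Real.cos (u * Y s ω)) ∂P = 0 := by
      rw [integral_sub (integrable_const _) hci, h2]
      simp
    have h5 := (integral_eq_zero_iff_of_nonneg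
      (fun ω => sub_nonneg.2 (Real.cos_le_one _)) ((integrable_const _).sub hci)).1 h4
    filter_upwards [h5] with ω hω
    simp only [Pi.zero_apply] at hω
    linarith
  have hall : ∀ᵐ ω ∂P, ∀ k : ℕ, Real.cos (δ / ((k : ℝ) + 2) * Y s ω) = 1 := by
    refine ae_all_iff.2 fun k => hcos _ ?_
    rw [abs_of_pos (by positivity), div_lt_iff₀ (by positivity)]
    have : (0 : ℝ) ≤ k := k.cast_nonneg
    nlinarith
  filter_upwards [hall] with ω hω
  obtain ⟨k, hk⟩ := exists_nat_gt (δ * |Y s ω|)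
  have hk2 : |δ / ((k : ℝ) + 2) * Y s ω| < 2 * Real.pi := by
    rw [abs_mul, abs_of_pos (by positivity), div_mul_eq_mul_div, div_lt_iff₀ (by positivity)]
    nlinarith [Real.pi_gt_three, (k.cast_nonneg : (0 : ℝ) ≤ k)]
  have := (Real.cos_eq_one_iff_of_lt_of_lt (abs_lt.1 hk2).1 (abs_lt.1 hk2).2).1 (hω k)
  have hne : δ / ((k : ℝ) + 2) ≠ 0 := by positivity
  exact (mul_eq_zero.1 this).resolve_left hne

/-- A Lévy process that is a.s. bounded above drifts to `-∞` or vanishes identically. -/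
lemma ae_tendsto_atBot_or_ae_eq_zero [IsProbabilityMeasure P] (hY : IsRegularLevyProcess P 𝓕 Y)
    (hbdd : ∀ᵐ ω ∂P, BddAbove (range fun t => Y t ω)) :
    (∀ᵐ ω ∂P, Tendsto (fun t => Y t ω) atTop atBot) ∨ ∀ᵐ ω ∂P, ∀ t, Y t ω = 0 := by
  by_cases hbot : ∀ᵐ ω ∂P, limsupFunctional (fun i => Y (denseTime i) ω) = ⊥
  · left
    filter_upwards [hbot] with ω hω
    rw [hY.limsupFunctional_path] at hω
    refine tendsto_atBot.2 fun b => ?_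
    have h1 : limsup (fun t => (Y t ω : EReal)) atTop < (b : EReal) := by
      rw [hω]; exact EReal.bot_lt_coe b
    filter_upwards [eventually_lt_of_limsup_lt h1] with t ht
    exact_mod_cast ht.le
  · right
    have htop : ∀ᵐ ω ∂P, limsupFunctional (fun i => Y (denseTime i) ω) ≠ ⊤ := by
      filter_upwards [hbdd] with ω hω
      obtain ⟨b, hb⟩ := hω
      rw [hY.limsupFunctional_path]
      have h1 : limsup (fun t => (Y t ω : EReal)) atTop ≤ (b : EReal) :=
        limsup_le_of_le (by isBoundedDefault) (Eventually.of_forall fun t => by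
          exact_mod_cast hb ⟨t, rfl⟩)
      exact ne_top_of_le_ne_top (EReal.coe_ne_top b) h1
    filter_upwards [ae_all_iff.2 fun k => hY.ae_eq_zero_of_limsup_ne_bot htop hbot (denseTime k)]
      with ω hω t
    by_contra hne
    have h1 : ∀ᶠ s in 𝓝[>] t, Y s ω ≠ 0 :=
      ((hY.rightCont ω t).mono Ioi_subset_Ici_self).eventually (isOpen_ne.mem_nhds hne)
    obtain ⟨u, hu, hsub⟩ := (mem_nhdsGT_iff_exists_Ioo_subset).1 h1
    obtain ⟨k, hk⟩ := exists_denseTime_mem_Ioo hu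
    exact hsub hk (hω k)

end IsRegularLevyProcess

/-! ### Real and extended-real suprema -/

lemma monotone_extendByZero {a : ℝ} {Gs : ℝ → ℝ} (hmono : MonotoneOn Gs (Ici a))
    (h0 : 0 ≤ Gs a) : Monotone (extendByZero a Gs) := by
  intro y z hyz
  unfold extendByZero
  split_ifs with hy hz hz
  · exact hmono hy hz hyz
  · exact absurd (hy.trans hyz) hz
  · exact h0.trans (hmono self_mem_Ici hz hz)
  · exact le_rfl

lemma extendByZero_nonneg {a : ℝ} {Gs : ℝ → ℝ} (hmono : MonotoneOn Gs (Ici a))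
    (h0 : 0 ≤ Gs a) (y : ℝ) : 0 ≤ extendByZero a Gs y := by
  unfold extendByZero
  split_ifs with hy
  · exact h0.trans (hmono self_mem_Ici hy hy)
  · exact le_rfl

/-- The monotone extension to `[-∞, ∞]` of the positive part of a monotone function on `ℝ`. -/
noncomputable def erealExtension (G : ℝ → ℝ) (e : EReal) : ℝ≥0∞ :=
  ⨆ (y : ℝ) (_ : (y : EReal) ≤ e), ENNReal.ofReal (G y)

lemma monotone_erealExtension (G : ℝ → ℝ) : Monotone (erealExtension G) := fun _ _ h =>
  iSup₂_le fun y hy => le_iSup₂ (f := fun (y : ℝ) (_ : (y : EReal) ≤ _) => ENNReal.ofReal (G y))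
    y (hy.trans h)

lemma erealExtension_coe {G : ℝ → ℝ} (hG : Monotone G) (y : ℝ) :
    erealExtension G y = ENNReal.ofReal (G y) := by
  refine le_antisymm (iSup₂_le fun z hz => ?_) ?_
  · exact ENNReal.ofReal_le_ofReal (hG (EReal.coe_le_coe_iff.1 hz))
  · exact le_iSup₂ (f := fun (z : ℝ) (_ : (z : EReal) ≤ y) => ENNReal.ofReal (G z)) y le_rfl

lemma erealExtension_extendByZero_of_lt {a : ℝ} {Gs : ℝ → ℝ} {e : EReal} (he : e < a) :
    erealExtension (extendByZero a Gs) e = 0 := by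
  refine le_antisymm (iSup₂_le fun y hy => ?_) zero_le
  have : y < a := EReal.coe_lt_coe_iff.1 (hy.trans_lt he)
  rw [extendByZero, if_neg (not_le.2 this), ENNReal.ofReal_zero]

lemma coe_overallSup {X : ℝ≥0 → Ω → ℝ} {p : Ω × ℝ≥0∞} (h : BddAbove (valuesUpTo X p)) :
    ((overallSup X p : ℝ) : EReal) = pathSup (fun t => X t p.1) p.2 := by
  have hle : pathSup (fun t => X t p.1) p.2 ≤ (overallSup X p : ℝ) :=
    pathSup_le fun t ht => EReal.coe_le_coe_iff.2 (le_csSup h ⟨t, ht, rfl⟩)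
  refine le_antisymm ?_ hle
  have htop : pathSup (fun t => X t p.1) p.2 ≠ ⊤ :=
    ne_top_of_le_ne_top (EReal.coe_ne_top _) hle
  have hlift := EReal.coe_toReal htop (bot_lt_pathSup (fun t => X t p.1) p.2).ne'
  rw [← hlift, EReal.coe_le_coe_iff]
  refine csSup_le ⟨X 0 p.1, 0, by simp, rfl⟩ ?_
  rintro _ ⟨t, ht, rfl⟩
  rw [← EReal.coe_le_coe_iff, hlift]
  exact le_pathSup (f := fun t => X t p.1) ht

lemma bddAbove_valuesUpTo_startedAt {p : Ω × ℝ≥0∞} (h : BddAbove (valuesUpTo Y p)) (x : ℝ) :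
    BddAbove (valuesUpTo (startedAt Y x) p) := by
  obtain ⟨b, hb⟩ := h
  refine ⟨x + b, ?_⟩
  rintro _ ⟨t, ht, rfl⟩
  exact add_le_add_right (hb ⟨t, ht, rfl⟩) x

lemma payoff_of_eq_top {r : ℝ} {g : ℝ → ℝ} {X : ℝ≥0 → Ω → ℝ} {τ : Ω → WithTop ℝ≥0} {ω : Ω}
    (h : τ ω = ⊤) : payoff r g X τ ω = limsup (fun t : ℝ≥0 => discounted r g X t ω) atTop := by
  rw [payoff, h]

lemma payoff_of_ne_top {r : ℝ} {g : ℝ → ℝ} {X : ℝ≥0 → Ω → ℝ} {τ : Ω → WithTop ℝ≥0} {ω : Ω}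
    (h : τ ω ≠ ⊤) : payoff r g X τ ω = ENNReal.ofReal (Real.exp (-r * (τ ω).untopD 0)) *
      ENNReal.ofReal (g (X ((τ ω).untopD 0) ω)) := by
  obtain ⟨t, ht⟩ := WithTop.ne_top_iff_exists.1 h
  rw [payoff, ← ht, WithTop.untopD_coe, ← ENNReal.ofReal_mul (Real.exp_nonneg _)]
  rfl

/-! ### The optimal stopping problem for regular paths -/

namespace IsRegularLevyProcess

lemma integrableSup_iff [IsProbabilityMeasure P] (hY : IsRegularLevyProcess P 𝓕 Y) {r : ℝ}
    (hM : ∀ᵐ p ∂(extendedLaw P r), BddAbove (valuesUpTo Y p)) {G : ℝ → ℝ} (hG : Monotone G)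
    (hG0 : ∀ y, 0 ≤ G y) (x : ℝ) :
    IntegrableSup P r Y G x ↔ supMean P r Y (erealExtension G) x ≠ ⊤ := by
  have hsup : ∀ᵐ p ∂extendedLaw P r, overallSup (startedAt Y x) p =
      (pathSup (fun t => startedAt Y x t p.1) p.2).toReal := by
    filter_upwards [hM] with p hp
    rw [← coe_overallSup (bddAbove_valuesUpTo_startedAt hp x), EReal.toReal_coe]
  have hmeas : AEStronglyMeasurable (fun p => G (overallSup (startedAt Y x) p))
      (extendedLaw P r) := by
    refine AEStronglyMeasurable.congr (f := fun p =>
      G (pathSup (fun t => startedAt Y x t p.1) p.2).toReal) ?_ ?_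
    · exact (hG.measurable.comp (hY.measurable_pathSup x).ereal_toReal).aestronglyMeasurable
    · filter_upwards [hsup] with p hp
      rw [hp]
  rw [IntegrableSup, ← lintegral_ofReal_ne_top_iff_integrable hmeas (ae_of_all _ fun p => hG0 _),
    supMean]
  refine not_congr (Eq.congr (lintegral_congr_ae ?_) rfl)
  filter_upwards [hM] with p hp
  rw [← coe_overallSup (bddAbove_valuesUpTo_startedAt hp x), erealExtension_coe hG]

lemma supMean_eq_ofReal (hM : ∀ᵐ p ∂(extendedLaw P r), BddAbove (valuesUpTo Y p))
    {G : ℝ → ℝ} (hG : Monotone G) (hG0 : ∀ y, 0 ≤ G y) {x : ℝ} (hint : IntegrableSup P r Y G x) :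
    supMean P r Y (erealExtension G) x = ENNReal.ofReal (expectSup P r Y G x) := by
  rw [expectSup, ofReal_integral_eq_lintegral_ofReal hint (ae_of_all _ fun p => hG0 _), supMean]
  refine lintegral_congr_ae ?_
  filter_upwards [hM] with p hp
  rw [← coe_overallSup (bddAbove_valuesUpTo_startedAt hp x), erealExtension_coe hG]

/-- To the right of the threshold `G(M)` and `Gs(M)` are the same variable. -/
lemma ae_extendByZero_overallSup (hY : IsRegularLevyProcess P 𝓕 Y) {r : ℝ}
    (hM : ∀ᵐ p ∂(extendedLaw P r), BddAbove (valuesUpTo Y p)) {xs x : ℝ} (hx : xs ≤ x)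
    (Gs : ℝ → ℝ) : (fun p => Gs (overallSup (startedAt Y x) p)) =ᵐ[extendedLaw P r]
      fun p => extendByZero xs Gs (overallSup (startedAt Y x) p) := by
  filter_upwards [hM] with p hp
  have h0 : startedAt Y x 0 p.1 ≤ overallSup (startedAt Y x) p :=
    le_csSup (bddAbove_valuesUpTo_startedAt hp x) ⟨0, by simp, rfl⟩
  rw [startedAt, hY.zero_apply, add_zero] at h0
  rw [extendByZero, if_pos (hx.trans h0)]

lemma expectedPayoff_le_of_tendsto [IsProbabilityMeasure P] (hY : IsRegularLevyProcess P 𝓕 Y)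
    {r : ℝ} (hr : 0 ≤ r) {g : ℝ → ℝ} {Ψ : EReal → ℝ≥0∞} (hΨ : Monotone Ψ)
    (hg : ∀ y, ENNReal.ofReal (g y) ≤ supMean P r Y Ψ y) (x : ℝ)
    (hlim : ∀ᵐ ω ∂P, Tendsto (fun t => discounted r g (startedAt Y x) t ω) atTop (𝓝 0))
    {τ : Ω → WithTop ℝ≥0} (hτ : IsStoppingTime 𝓕 τ) :
    expectedPayoff P r g (startedAt Y x) τ ≤ supMean P r Y Ψ x := by
  have hA : MeasurableSet {ω | τ ω ≠ ⊤} := hτ.measurableSet_eq_top.compl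
  have hae : payoff r g (startedAt Y x) τ =ᵐ[P] {ω | τ ω ≠ ⊤}.indicator fun ω =>
      ENNReal.ofReal (Real.exp (-r * (τ ω).untopD 0)) *
        ENNReal.ofReal (g (startedAt Y x ((τ ω).untopD 0) ω)) := by
    filter_upwards [hlim] with ω hω
    by_cases h : τ ω = ⊤
    · rw [indicator_of_notMem (by simpa using h), payoff_of_eq_top h, hω.limsup_eq]
    · rw [indicator_of_mem (by exact h), payoff_of_ne_top h]
  rw [expectedPayoff, lintegral_congr_ae hae, lintegral_indicator hA]
  calc _ ≤ ∫⁻ ω in {ω | τ ω ≠ ⊤}, ENNReal.ofReal (Real.exp (-r * (τ ω).untopD 0)) *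
        supMean P r Y Ψ (startedAt Y x ((τ ω).untopD 0) ω) ∂P :=
        lintegral_mono fun ω => by gcongr; exact hg _
    _ ≤ _ := hY.lintegral_exp_mul_supMean_le hr hτ hΨ x
    _ ≤ _ := setLIntegral_le_lintegral _ _

/-- No stopping time does better than the value function. -/
lemma expectedPayoff_le [IsProbabilityMeasure P] (hY : IsRegularLevyProcess P 𝓕 Y)
    {r : ℝ} (hr : 0 ≤ r) (hM : ∀ᵐ p ∂(extendedLaw P r), BddAbove (valuesUpTo Y p)) {g : ℝ → ℝ}
    (hg_lim : Tendsto g atBot (𝓝 0)) {Ψ : EReal → ℝ≥0∞} (hΨ : Monotone Ψ)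
    (hfin : ∀ y, supMean P r Y Ψ y ≠ ⊤)
    (hg : ∀ y, ENNReal.ofReal (g y) ≤ supMean P r Y Ψ y) (x : ℝ)
    {τ : Ω → WithTop ℝ≥0} (hτ : IsStoppingTime 𝓕 τ) :
    expectedPayoff P r g (startedAt Y x) τ ≤ supMean P r Y Ψ x := by
  rcases hr.eq_or_lt with rfl | hr0
  · have hbdd : ∀ᵐ ω ∂P, BddAbove (range fun t => Y t ω) := by
      rw [extendedLaw, horizonLaw, if_pos rfl] at hM
      filter_upwards [Measure.ae_ae_of_ae_prod hM] with ω hω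
      rw [ae_dirac_eq] at hω
      refine BddAbove.mono ?_ hω
      rintro _ ⟨t, rfl⟩
      exact ⟨t, le_top, rfl⟩
    rcases hY.ae_tendsto_atBot_or_ae_eq_zero hbdd with h | h
    · refine hY.expectedPayoff_le_of_tendsto hr hΨ hg x ?_ hτ
      filter_upwards [h] with ω hω
      have h1 : Tendsto (fun t => g (startedAt Y x t ω)) atTop (𝓝 0) :=
        hg_lim.comp (tendsto_atBot_add_const_left _ x hω)
      simpa [discounted] using ENNReal.tendsto_ofReal h1
    · -- a vanishing process: every rule yields `g x`
      have hae : payoff 0 g (startedAt Y x) τ =ᵐ[P] fun _ => ENNReal.ofReal (g x) := by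
        filter_upwards [h] with ω hω
        by_cases hω' : τ ω = ⊤
        · rw [payoff_of_eq_top hω']
          simp [discounted, startedAt, hω]
        · rw [payoff_of_ne_top hω']
          simp [startedAt, hω]
      rw [expectedPayoff, lintegral_congr_ae hae]
      simpa using hg x
  · refine hY.expectedPayoff_le_of_tendsto hr hΨ hg x ?_ hτ
    filter_upwards [hY.ae_tendsto_exp_mul_supMean hr0 hΨ x (hfin _)] with ω hω
    refine tendsto_of_tendsto_of_tendsto_of_le_of_le tendsto_const_nhds hω
      (fun t => zero_le) fun t => ?_
    rw [discounted, ENNReal.ofReal_mul (Real.exp_nonneg _)]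
    gcongr
    exact hg _

/-- The first entrance time attains the value function: on `{τ* ≤ e(r)}` the overall supremum is
the supremum after `τ*`, and off this event `G(M) = 0` almost surely. -/
lemma le_expectedPayoff_entranceTime [IsProbabilityMeasure P] (hY : IsRegularLevyProcess P 𝓕 Y)
    (h𝓕 : UsualConditions P 𝓕) {r : ℝ} (hr : 0 ≤ r) {g : ℝ → ℝ} {xs : ℝ} {Gs : ℝ → ℝ}
    (hg : ∀ y, xs ≤ y →
      ENNReal.ofReal (g y) = supMean P r Y (erealExtension (extendByZero xs Gs)) y) (x : ℝ) :
    supMean P r Y (erealExtension (extendByZero xs Gs)) x ≤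
      expectedPayoff P r g (startedAt Y x) (entranceTime (startedAt Y x) xs) := by
  set X := startedAt Y x with hX
  set τ := entranceTime X xs with hτdef
  set Ψ := erealExtension (extendByZero xs Gs) with hΨdef
  have hΨ : Monotone Ψ := monotone_erealExtension _
  have hτ : IsStoppingTime 𝓕 τ := hY.isStoppingTime_entranceTime h𝓕 x xs
  have hA : MeasurableSet {ω | τ ω ≠ ⊤} := hτ.measurableSet_eq_top.compl
  have hXσ : ∀ ω, τ ω ≠ ⊤ → xs ≤ X ((τ ω).untopD 0) ω := fun ω hω =>
    le_apply_untopD_hittingAfter (hY.rightCont_startedAt x ω) subset_rfl hω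
  calc supMean P r Y Ψ x
      = ∫⁻ p in reached τ, Ψ (pathSup (fun t => X t p.1) p.2) ∂extendedLaw P r := by
        rw [← lintegral_indicator (measurableSet_reached hτ), supMean]
        refine lintegral_congr_ae ?_
        filter_upwards [hY.ae_pathSup_ne_of_lt h𝓕.rightContinuous hr x xs] with p hp
        by_cases hmem : p ∈ reached τ
        · rw [indicator_of_mem hmem]
        · rw [indicator_of_notMem hmem]
          have hlt : ∀ t : ℝ≥0, (t : ℝ≥0∞) ≤ p.2 → X t p.1 < xs := by
            intro t ht
            by_contra! hge
            obtain ⟨h1, h2⟩ := untopD_hittingAfter_le (s := Ici xs) hge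
            exact hmem ⟨h1, (ENNReal.coe_le_coe.2 h2).trans ht⟩
          refine erealExtension_extendByZero_of_lt (lt_of_le_of_ne (pathSup_le fun t ht => ?_)
            (hp hlt))
          exact_mod_cast (hlt t ht).le
    _ ≤ ∫⁻ p in reached τ, Ψ (pathSup (fun t => X ((τ p.1).untopD 0 + t) p.1)
        (p.2 - ((τ p.1).untopD 0 : ℝ≥0))) ∂extendedLaw P r := by
        refine setLIntegral_mono' (measurableSet_reached hτ) fun p hp =>
          hΨ (pathSup_le fun t ht => ?_)
        rcases le_or_gt ((τ p.1).untopD 0) t with hle | hlt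
        · have h1 := le_pathSup (f := fun t => X ((τ p.1).untopD 0 + t) p.1)
            (t := t - (τ p.1).untopD 0) (T := p.2 - ((τ p.1).untopD 0 : ℝ≥0))
            (by rw [ENNReal.coe_sub]; exact tsub_le_tsub_right ht _)
          rwa [add_tsub_cancel_of_le hle] at h1
        · have h1 := le_pathSup (f := fun t => X ((τ p.1).untopD 0 + t) p.1)
            (t := 0) (T := p.2 - ((τ p.1).untopD 0 : ℝ≥0)) (by simp)
          refine le_trans ?_ h1
          have h2 : X t p.1 ≤ xs := by
            by_contra! hgt
            exact absurd (untopD_hittingAfter_le (s := Ici xs) hgt.le).2 (not_le.2 hlt)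
          have h3 := h2.trans (hXσ p.1 hp.1)
          rw [add_zero]
          exact_mod_cast h3
    _ = ∫⁻ ω in {ω | τ ω ≠ ⊤}, ENNReal.ofReal (Real.exp (-r * (τ ω).untopD 0)) *
        supMean P r Y Ψ (X ((τ ω).untopD 0) ω) ∂P :=
        (hY.lintegral_exp_mul_valueAt hr hτ hΨ.measurable x).symm
    _ = ∫⁻ ω in {ω | τ ω ≠ ⊤}, payoff r g X τ ω ∂P := by
        refine setLIntegral_congr_fun hA fun ω hω => ?_
        rw [payoff_of_ne_top hω, hg _ (hXσ ω hω)]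
    _ ≤ _ := setLIntegral_le_lintegral _ _

theorem optimalStopping [IsProbabilityMeasure P] (hY : IsRegularLevyProcess P 𝓕 Y)
    (h𝓕 : UsualConditions P 𝓕) {r : ℝ} (hr : 0 ≤ r)
    (hM : ∀ᵐ p ∂(extendedLaw P r), BddAbove (valuesUpTo Y p))
    {g : ℝ → ℝ} (hg_lim : Tendsto g atBot (𝓝 0))
    {xs : ℝ} {Gs : ℝ → ℝ} (hGs_mono : MonotoneOn Gs (Ici xs)) (hGs_nonneg : 0 ≤ Gs xs)
    (hGs_avg : ∀ x, xs ≤ x → IntegrableSup P r Y Gs x ∧ expectSup P r Y Gs x = g x)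
    (hV : ∀ x, x < xs → g x ≤ expectSup P r Y (extendByZero xs Gs) x) (x : ℝ) :
    IntegrableSup P r Y (extendByZero xs Gs) x ∧
      optimalValue P 𝓕 r g (startedAt Y x) =
        ENNReal.ofReal (expectSup P r Y (extendByZero xs Gs) x) ∧
      IsStoppingTime 𝓕 (entranceTime (startedAt Y x) xs) ∧
      expectedPayoff P r g (startedAt Y x) (entranceTime (startedAt Y x) xs) =
        optimalValue P 𝓕 r g (startedAt Y x) := by
  have hG := monotone_extendByZero hGs_mono hGs_nonneg
  have hG0 := extendByZero_nonneg hGs_mono hGs_nonneg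
  set Ψ := erealExtension (extendByZero xs Gs) with hΨdef
  have hΨ : Monotone Ψ := monotone_erealExtension _
  have hright : ∀ y, xs ≤ y → IntegrableSup P r Y (extendByZero xs Gs) y := fun y hy =>
    (hGs_avg y hy).1.congr (hY.ae_extendByZero_overallSup hM hy Gs)
  have hint : ∀ y, IntegrableSup P r Y (extendByZero xs Gs) y := by
    intro y
    rcases le_or_gt xs y with hy | hy
    · exact hright y hy
    · rw [hY.integrableSup_iff hM hG hG0]
      exact ne_top_of_le_ne_top ((hY.integrableSup_iff hM hG hG0 xs).1 (hright xs le_rfl))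
        (monotone_supMean P r Y hΨ hy.le)
  have hval : ∀ y, supMean P r Y Ψ y = ENNReal.ofReal (expectSup P r Y (extendByZero xs Gs) y) :=
    fun y => supMean_eq_ofReal hM hG hG0 (hint y)
  have hgeq : ∀ y, xs ≤ y → ENNReal.ofReal (g y) = supMean P r Y Ψ y := by
    intro y hy
    rw [hval, ← (hGs_avg y hy).2]
    congr 1
    exact integral_congr_ae (hY.ae_extendByZero_overallSup hM hy Gs)
  have hgle : ∀ y, ENNReal.ofReal (g y) ≤ supMean P r Y Ψ y := by
    intro y
    rcases le_or_gt xs y with hy | hy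
    · exact (hgeq y hy).le
    · rw [hval]
      exact ENNReal.ofReal_le_ofReal (hV y hy)
  have hent := hY.isStoppingTime_entranceTime h𝓕 x xs
  have hupper : optimalValue P 𝓕 r g (startedAt Y x) ≤ supMean P r Y Ψ x :=
    iSup₂_le fun τ hτ => hY.expectedPayoff_le hr hM hg_lim hΨ
      (fun y => (hY.integrableSup_iff hM hG hG0 y).1 (hint y)) hgle x hτ
  have hlower := hY.le_expectedPayoff_entranceTime h𝓕 hr hgeq x
  have hle : expectedPayoff P r g (startedAt Y x) (entranceTime (startedAt Y x) xs) ≤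
      optimalValue P 𝓕 r g (startedAt Y x) :=
    le_iSup₂ (f := fun τ (_ : IsStoppingTime 𝓕 τ) => expectedPayoff P r g (startedAt Y x) τ)
      _ hent
  refine ⟨hint x, ?_, hent, le_antisymm hle (hupper.trans hlower)⟩
  rw [← hval]
  exact le_antisymm hupper (hlower.trans hle)

end IsRegularLevyProcess

/-! ### Regularization of the paths -/

open Classical in
/-- The process set to `0` on the paths that do not start from `0` or are not càdlàg. -/
noncomputable def regularize (Y : ℝ≥0 → Ω → ℝ) : ℝ≥0 → Ω → ℝ := fun t ω =>
  if Y 0 ω = 0 ∧ IsCadlagPath (fun t => Y t ω) then Y t ω else 0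

namespace IsLevyProcess

lemma ae_regularize_eq (hY : IsLevyProcess P 𝓕 Y) : ∀ᵐ ω ∂P, ∀ t, regularize Y t ω = Y t ω := by
  filter_upwards [hY.start_zero, hY.cadlag] with ω h1 h2 t
  exact if_pos ⟨h1, h2⟩

lemma isRegularLevyProcess_regularize (hY : IsLevyProcess P 𝓕 Y) (h𝓕 : UsualConditions P 𝓕) :
    IsRegularLevyProcess P 𝓕 (regularize Y) := by
  have hae := hY.ae_regularize_eq
  have hgood : MeasurableSet[𝓕 0] {ω | Y 0 ω = 0 ∧ IsCadlagPath fun t => Y t ω} := by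
    have h0 : P {ω | Y 0 ω = 0 ∧ IsCadlagPath fun t => Y t ω}ᶜ = 0 :=
      ae_iff.1 (hY.start_zero.and hY.cadlag)
    exact (h𝓕.complete _ h0).of_compl
  have hadapted : ∀ t, Measurable[𝓕 t] (regularize Y t) := fun t =>
    Measurable.ite (𝓕.mono zero_le _ hgood) (hY.adapted t) measurable_const
  have hincr : ∀ s t, (fun ω => regularize Y t ω - regularize Y s ω) =ᵐ[P]
      fun ω => Y t ω - Y s ω := by
    intro s t
    filter_upwards [hae] with ω hω
    rw [hω, hω]
  have hcad : ∀ ω, IsCadlagPath fun t => regularize Y t ω := by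
    intro ω
    by_cases h : Y 0 ω = 0 ∧ IsCadlagPath fun t => Y t ω
    · simpa only [regularize, if_pos h] using h.2
    · simp only [regularize, if_neg h]
      exact fun t => ⟨continuousWithinAt_const, 0, tendsto_const_nhds⟩
  have hzero : ∀ ω, regularize Y 0 ω = 0 := by
    intro ω
    by_cases h : Y 0 ω = 0 ∧ IsCadlagPath fun t => Y t ω
    · simp only [regularize, if_pos h, h.1]
    · simp only [regularize, if_neg h]
  refine ⟨⟨hadapted, ae_of_all _ hzero, ae_of_all _ hcad, fun s t hst => ?_, fun s t => ?_⟩,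
    hzero, fun ω t => (hcad ω t).1⟩
  · rw [Indep_iff]
    rintro _ A ⟨C, hC, rfl⟩ hA
    have h1 : ((fun ω => regularize Y t ω - regularize Y s ω) ⁻¹' C : Set Ω) =ᵐ[P]
        (fun ω => Y t ω - Y s ω) ⁻¹' C := (hincr s t).preimage C
    rw [measure_congr h1, measure_congr (h1.inter (ae_eq_refl A))]
    exact (Indep_iff _ _ P).1 (hY.indep_increments s t hst) _ A ⟨C, hC, rfl⟩ hA
  · have h := hY.stationary_increments s t
    refine ⟨h.aemeasurable_fst.congr (hincr _ _).symm, h.aemeasurable_snd.congr (hincr _ _).symm,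
      ?_⟩
    rw [Measure.map_congr (hincr _ _), Measure.map_congr (hincr _ _), h.map_eq]

end IsLevyProcess

lemma ae_extendedLaw_of_ae [SFinite P] {r : ℝ} (hr : 0 ≤ r) {p : Ω → Prop} (h : ∀ᵐ ω ∂P, p ω) :
    ∀ᵐ q ∂extendedLaw P r, p q.1 := by
  have := isProbabilityMeasure_horizonLaw hr
  exact Measure.quasiMeasurePreserving_fst.ae h

/-- By completeness, a random time that agrees almost surely with a stopping time is a stopping
time. -/
lemma isStoppingTime_congr_ae (h𝓕 : UsualConditions P 𝓕) {τ τ' : Ω → WithTop ℝ≥0}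
    (hτ : IsStoppingTime 𝓕 τ) (h : τ =ᵐ[P] τ') : IsStoppingTime 𝓕 τ' := by
  intro i
  have hN : P {ω | τ ω ≠ τ' ω} = 0 := h
  have hN' : P ({ω | τ' ω ≤ i} ∩ {ω | τ ω ≠ τ' ω}) = 0 := measure_mono_null inter_subset_right hN
  have : {ω | τ' ω ≤ i} = ({ω | τ ω ≤ i} \ {ω | τ ω ≠ τ' ω}) ∪
      ({ω | τ' ω ≤ i} ∩ {ω | τ ω ≠ τ' ω}) := by
    ext ω
    by_cases hω : τ ω = τ' ω <;> simp [hω]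
  rw [this]
  exact ((hτ i).diff (𝓕.mono zero_le _ (h𝓕.complete _ hN))).union
    (𝓕.mono zero_le _ (h𝓕.complete _ hN'))

end LevyStopping

theorem theorem1 {Ω : Type*} {mΩ : MeasurableSpace Ω} (P : Measure Ω) [IsProbabilityMeasure P]
    (𝓕 : Filtration ℝ≥0 mΩ) (h𝓕 : UsualConditions P 𝓕)
    (Y : ℝ≥0 → Ω → ℝ) (hY : IsLevyProcess P 𝓕 Y)
    (r : ℝ) (hr : 0 ≤ r)
    -- the overall supremum is a proper random variable
    (hM : ∀ᵐ p ∂(extendedLaw P r), BddAbove (valuesUpTo Y p))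
    (g : ℝ → ℝ) (hg_meas : Measurable g) (hg_nonneg : ∀ x, 0 ≤ g x)
    (hg_lim : Tendsto g atBot (𝓝 0))
    (xs : ℝ) (Gs : ℝ → ℝ) (hGs_mono : MonotoneOn Gs (Ici xs)) (hGs_nonneg : 0 ≤ Gs xs)
    (hGs_avg : ∀ x, xs ≤ x → IntegrableSup P r Y Gs x ∧ expectSup P r Y Gs x = g x)
    (hV : ∀ x, x < xs → g x ≤ expectSup P r Y (extendByZero xs Gs) x) :
    ∀ x : ℝ,
      IntegrableSup P r Y (extendByZero xs Gs) x ∧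
      optimalValue P 𝓕 r g (startedAt Y x) =
        ENNReal.ofReal (expectSup P r Y (extendByZero xs Gs) x) ∧
      IsStoppingTime 𝓕 (entranceTime (startedAt Y x) xs) ∧
      expectedPayoff P r g (startedAt Y x) (entranceTime (startedAt Y x) xs) =
        optimalValue P 𝓕 r g (startedAt Y x) := by
  intro x
  set Y' := regularize Y with hY'def
  have hY' : IsRegularLevyProcess P 𝓕 Y' := hY.isRegularLevyProcess_regularize h𝓕
  have hae : ∀ᵐ ω ∂P, ∀ t, Y' t ω = Y t ω := hY.ae_regularize_eq
  -- all quantities in the statement agree for `Y` and its regularization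
  have haeX : ∀ (F : ℝ → ℝ) (x : ℝ), (fun p => F (overallSup (startedAt Y' x) p))
      =ᵐ[extendedLaw P r] fun p => F (overallSup (startedAt Y x) p) := by
    intro F x
    filter_upwards [ae_extendedLaw_of_ae hr hae] with p hp
    simp only [overallSup, valuesUpTo, startedAt, hp]
  have hint : ∀ (F : ℝ → ℝ) (x : ℝ), IntegrableSup P r Y' F x ↔ IntegrableSup P r Y F x :=
    fun F x => integrable_congr (haeX F x)
  have hexp : ∀ (F : ℝ → ℝ) (x : ℝ), expectSup P r Y' F x = expectSup P r Y F x :=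
    fun F x => integral_congr_ae (haeX F x)
  have hpay : ∀ τ, expectedPayoff P r g (startedAt Y' x) τ =
      expectedPayoff P r g (startedAt Y x) τ := by
    intro τ
    refine lintegral_congr_ae ?_
    filter_upwards [hae] with ω hω
    simp only [payoff, discounted, startedAt, hω]
  have hopt : optimalValue P 𝓕 r g (startedAt Y' x) = optimalValue P 𝓕 r g (startedAt Y x) := by
    simp only [optimalValue, hpay]
  have hent : entranceTime (startedAt Y' x) xs =ᵐ[P] entranceTime (startedAt Y x) xs := by
    filter_upwards [hae] with ω hω
    classical
    refine if_congr ?_ ?_ rfl <;> simp only [startedAt, hω]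
  have hpayent : expectedPayoff P r g (startedAt Y x) (entranceTime (startedAt Y' x) xs) =
      expectedPayoff P r g (startedAt Y x) (entranceTime (startedAt Y x) xs) := by
    refine lintegral_congr_ae ?_
    filter_upwards [hent] with ω hω
    simp only [payoff, hω]
  have hM' : ∀ᵐ p ∂(extendedLaw P r), BddAbove (valuesUpTo Y' p) := by
    filter_upwards [hM, ae_extendedLaw_of_ae hr hae] with p hp hp'
    simpa only [valuesUpTo, hp'] using hp
  obtain ⟨h1, h2, h3, h4⟩ := hY'.optimalStopping h𝓕 hr hM' hg_lim hGs_mono hGs_nonneg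
    (fun y hy => ⟨(hint Gs y).2 (hGs_avg y hy).1, (hexp Gs y).trans (hGs_avg y hy).2⟩)
    (fun y hy => (hV y hy).trans_eq (hexp _ y).symm) x
  refine ⟨(hint _ x).1 h1, ?_, isStoppingTime_congr_ae h𝓕 h3 hent, ?_⟩
  · rw [← hopt, h2, hexp]
  · rw [← hopt, ← h4, hpay, hpayent]
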